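/- An affine semigroup is a finitely generated submonoid $S$ of $\mathbb{N}^d$. Its embedding dimension is the number $n$ of elements of its unique minimal generating set $\{a_1,\dots,a_n\}$. Let $\mathrm{cone}(S)$ be the set of nonnegative rational combinations of elements of $S$, and let $\mathrm{PF}(S)$ be the set of all $f\in(\mathrm{cone}(S)\setminus S)\cap\mathbb{N}^d$ such that $f+s\in S$ for all $s\in S\setminus\{0\}$. The Betti-type of $S$ is $|\mathrm{PF}(S)|$. For a field $k$, view the semigroup ring $k[S]$ as a module over $R=k[x_1,\dots,x_n]$ via $x_i\mapsto \mathbf{t}^{a_i}$; $S$ is an MPD-semigroup if $\mathrm{pdim}_R\,k[S]=n-1$ (below, this holds over every field $k$). Let $G(S)\subseteq\mathbb{Z}^d$ be the group spanned by $S$. If the minimal generating set of $S$ is a disjoint union of nonempty sets $A_1,A_2$, and $S_i=\langle A_i\rangle$, then $S$ is the gluing of $S_1$ and $S_2$ by $g$ if $g\in S_1\cap S_2$ and $G(S_1)\cap G(S_2)=g\mathbb{Z}$. For every $e\ge 4$ there are MPD-semigroups in $\mathbb{N}^2$ of embedding dimension $e$ with arbitrarily large finite Betti-type. More precisely, let $a\ge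 3$ be odd and $p\ge 1$, and put $$S_{a,p}=\langle (a,0),(0,a^p),(a+2,2),(2,2+a^p)\rangle .$$ 1. ($e=4$.) $S_{a,p}$ is an MPD-semigroup of embedding dimension $4$, and its Betti-type is finite and at least $a^p-1$. 2. ($e=5$.) Let $m\ge 2$, and assume $p\ge 2$ or $\gcd(a,m)=1$. Then the semigroup generated by $m\,S_{a,p}$ and $(a,a^p)$ is the gluing of $m\,S_{a,p}$ and $\mathbb{N}(a,a^p)$ by $m(a,a^p)$; it is an MPD-semigroup of embedding dimension $5$, and its Betti-type is finite and at least $a^p-1$. 3. ($e=s+4\ge 6$.) Let $S_1$ be a numerical semigroup (a submonoid of $\mathbb{N}$ with finite complement) with minimal generators $n_1,\dots,n_s$, $s\ge 2$. Let $\mu=n_1+\dots+n_s$, and let $\nu$ be the number of pseudo-Frobenius numbers of $S_1$, that is, of $f\in\mathbb{N}\setminus S_1$ with $f+t\in S_1$ for all $t\in S_1\setminus\{0\}$. Assume $p\ge 2$ or $\gcd(a,\mu)=1$. Then $$S_{a,p,s}=\langle \mu(a,0),\mu(0,a^p),\mu(a+2,2),\mu(2,2+a^p),n_1(a,a^p),\dots,n_s(a,a^p)\rangle$$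 is the gluing of $\mu\,S_{a,p}$ and $\langle n_1(a,a^p),\dots,n_s(a,a^p)\rangle$ by $\mu(a,a^p)$; it is an MPD-semigroup of embedding dimension $s+4$, and its Betti-type is finite and at least $\nu(a^p-1)$. -/

import Mathlib

universe u

noncomputable section

namespace AffineSemigroup

/-- The minimal system of generators (Hilbert basis) of a submonoid `S` of `ℕ^d` or of `ℕ`: the
nonzero elements of `S` that are not a sum of two nonzero elements of `S`. -/
def minGens {M : Type*} [AddCommMonoid M] (S : AddSubmonoid M) : Set M :=
  {a | a ∈ S ∧ a ≠ 0 ∧ ∀ b ∈ S, ∀ c ∈ S, a = b + c → b = 0 ∨ c = 0}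

/-- The embedding dimension: the number of minimal generators (used for finitely generated `S`). -/
def embDim {M : Type*} [AddCommMonoid M] (S : AddSubmonoid M) : ℕ :=
  (minGens S).ncard

/-- The rational cone of `S`: all nonnegative rational combinations of elements of `S`. -/
def cone {d : ℕ} (S : AddSubmonoid (Fin d → ℕ)) : Submodule ℚ≥0 (Fin d → ℚ) :=
  Submodule.span ℚ≥0 ((fun (a : Fin d → ℕ) (i : Fin d) => (a i : ℚ)) '' (S : Set (Fin d → ℕ)))

/-- The gaps `H(S) = (cone(S) \ S) ∩ ℕ^d`. -/
def gaps {d : ℕ} (S : AddSubmonoid (Fin d → ℕ)) : Set (Fin d → ℕ) :=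
  {f | (fun i => (f i : ℚ)) ∈ cone S ∧ f ∉ S}

/-- The set `PF(S)` of pseudo-Frobenius elements. -/
def PF {d : ℕ} (S : AddSubmonoid (Fin d → ℕ)) : Set (Fin d → ℕ) :=
  {f | f ∈ gaps S ∧ ∀ s ∈ S, s ≠ 0 → f + s ∈ S}

/-- The Betti-type: the number of pseudo-Frobenius elements (used together with finiteness). -/
def bettiType {d : ℕ} (S : AddSubmonoid (Fin d → ℕ)) : ℕ :=
  (PF S).ncard

/-- The presentation `k[x_a : a a minimal generator of S] → k[S]`, `x_a ↦ t^a`, of the semigroup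
ring `k[S]`. -/
def presentation (k : Type*) [Field k] {d : ℕ} (S : AddSubmonoid (Fin d → ℕ)) :
    MvPolynomial (minGens S) k →ₐ[k] AddMonoidAlgebra k S :=
  MvPolynomial.aeval fun a => AddMonoidAlgebra.single (⟨a.1, a.2.1⟩ : S) (1 : k)

/-- `k[S]` as a module over the polynomial ring `R = k[x_a : a a minimal generator of S]`. -/
def semigroupModule (k : Type*) [Field k] {d : ℕ} (S : AddSubmonoid (Fin d → ℕ)) :
    ModuleCat (MvPolynomial (minGens S) k) :=
  (ModuleCat.restrictScalars (presentation k S).toRingHom).obj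
    (ModuleCat.of (AddMonoidAlgebra k S) (AddMonoidAlgebra k S))

/-- `S` is an affine semigroup of maximal projective dimension over `k`: it is finitely generated
and `pdim_R k[S] = n - 1`, where `n` is the number of minimal generators of `S`. -/
def IsMPD (k : Type*) [Field k] {d : ℕ} (S : AddSubmonoid (Fin d → ℕ)) : Prop :=
  S.FG ∧ CategoryTheory.projectiveDimension (semigroupModule k S) + 1 = (embDim S : WithBot ℕ∞)

/-- The subgroup `G(S)` of `ℤ^d` spanned by `S`. -/
def groupOf {d : ℕ} (S : AddSubmonoid (Fin d → ℕ)) : AddSubgroup (Fin d → ℤ) :=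
  AddSubgroup.closure ((fun (a : Fin d → ℕ) (i : Fin d) => (a i : ℤ)) '' (S : Set (Fin d → ℕ)))

/-- `S` is the gluing of `S₁` and `S₂` by `s`. -/
def IsGluing {d : ℕ} (S S₁ S₂ : AddSubmonoid (Fin d → ℕ)) (s : Fin d → ℕ) : Prop :=
  S.FG ∧
  (∃ A₁ A₂ : Set (Fin d → ℕ), A₁.Nonempty ∧ A₂.Nonempty ∧ Disjoint A₁ A₂ ∧
    A₁ ∪ A₂ = minGens S ∧ AddSubmonoid.closure A₁ = S₁ ∧ AddSubmonoid.closure A₂ = S₂) ∧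
  s ∈ S₁ ∧ s ∈ S₂ ∧
  groupOf S₁ ⊓ groupOf S₂ = AddSubgroup.zmultiples (fun i => (s i : ℤ))

/-- `n₁, …, n_s` are (without repetition) the minimal generators of a numerical semigroup, that is,
of a submonoid of `ℕ` with finite complement. -/
def IsNumericalGenerators {s : ℕ} (n : Fin s → ℕ) : Prop :=
  Function.Injective n ∧
  minGens (AddSubmonoid.closure (Set.range n)) = Set.range n ∧
  {x : ℕ | x ∉ AddSubmonoid.closure (Set.range n)}.Finite

/-- The pseudo-Frobenius numbers of a numerical semigroup. -/
def numericalPF (T : AddSubmonoid ℕ) : Set ℕ :=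
  {f | f ∉ T ∧ ∀ t ∈ T, t ≠ 0 → f + t ∈ T}

/-- The four generators of `S_{a,p}`. -/
def sapGens (a p : ℕ) : Set (Fin 2 → ℕ) :=
  {![a, 0], ![0, a ^ p], ![a + 2, 2], ![2, 2 + a ^ p]}

/-- `S_{a,p} = ⟨(a,0), (0,a^p), (a+2,2), (2,2+a^p)⟩`. -/
def sap (a p : ℕ) : AddSubmonoid (Fin 2 → ℕ) :=
  AddSubmonoid.closure (sapGens a p)

/-- The generators of `S_{a,p}`, scaled by `m`. -/
def scaledSapGens (a p m : ℕ) : Set (Fin 2 → ℕ) :=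
  (fun v => m • v) '' sapGens a p

/-- The vectors `n_i (a, a^p)`. -/
def scaledNumGens (a p : ℕ) {s : ℕ} (n : Fin s → ℕ) : Set (Fin 2 → ℕ) :=
  Set.range fun i => n i • ![a, a ^ p]

/-- The semigroup generated by the vectors `m v`, `v` a generator of `S_{a,p}`, and the vectors
`n_i (a, a^p)`. -/
def glued (a p m : ℕ) {s : ℕ} (n : Fin s → ℕ) : AddSubmonoid (Fin 2 → ℕ) :=
  AddSubmonoid.closure (scaledSapGens a p m ∪ scaledNumGens a p n)

/-- `glued a p m n` is the gluing of the scaled `S_{a,p}` and the scaled numerical semigroup by the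
element `m (a, a^p)`. -/
def IsSapGluing (a p m : ℕ) {s : ℕ} (n : Fin s → ℕ) : Prop :=
  IsGluing (glued a p m n) (AddSubmonoid.closure (scaledSapGens a p m))
    (AddSubmonoid.closure (scaledNumGens a p n)) (m • ![a, a ^ p])

end AffineSemigroup

end

/-!
If `f` is pseudo-Frobenius for `S ⊆ ℕᵈ` and `R = k[x₁, …, xₙ]`, then `k[S] + k tᶠ` is an
`R`-submodule of `k[ℕᵈ]`, and there is an exact sequence `0 → k[S] → k[S] + k tᶠ → k → 0`. Its first
two terms are free over `k[x₁]`, so their projective dimension over `R` is at most `n - 1`, whereas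
`k` has projective dimension `n`; hence `k[S]` has projective dimension exactly `n - 1`.

In the gluing of `m S` and `T c`, where `T ⊆ ℕ` and `c ∈ ℕᵈ`, every `f ∈ PF(S)` and every maximal
element `t` of the Apéry set of `T` with respect to `m` yield the pseudo-Frobenius element
`m f + t c`, and distinct pairs yield distinct elements.

With `q = aᵖ`, the vectors `(q - 1) (2, 2) + α (a, 0) + β (0, q)`, `α + β = q - 2`, are `q - 1`
pseudo-Frobenius elements of `S_{a,p}`: one copy of `(2, 2)` too many keeps them out of `S_{a,p}`,
while one more copy makes `q (2, 2)`, which can be traded for `2 aᵖ⁻¹ (a, 0) + 2 (0, q)`.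
-/

noncomputable section

namespace AffineSemigroup

section MinimalGenerators

variable {M : Type*} [AddCommMonoid M] {S : AddSubmonoid M}

lemma minGens_closure_subset (A : Set M) : minGens (AddSubmonoid.closure A) ⊆ A := by
  rintro a ⟨ha, ha0, hirr⟩
  have exists_split : ∀ x ∈ AddSubmonoid.closure A,
      x = 0 ∨ ∃ g ∈ A, g ≠ 0 ∧ ∃ y ∈ AddSubmonoid.closure A, x = g + y := by
    intro x hx
    induction hx using AddSubmonoid.closure_induction_left with
    | zero => exact .inl rfl
    | add_left g hg y hy ih =>
      by_cases hg0 : g = 0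
      · rwa [hg0, zero_add]
      · exact .inr ⟨g, hg, hg0, y, hy, rfl⟩
  obtain h | ⟨g, hg, hg0, y, hy, rfl⟩ := exists_split a ha
  · exact absurd h ha0
  · rw [(hirr g (AddSubmonoid.subset_closure hg) y hy rfl).resolve_left hg0, add_zero]
    exact hg

lemma finite_minGens (hfg : S.FG) : (minGens S).Finite := by
  obtain ⟨A, rfl⟩ := hfg
  exact A.finite_toSet.subset (minGens_closure_subset _)

lemma notMem_minGens_add_nsmul {g v c : M} {r : ℕ} (hv : v ∈ S) (hc : c ∈ S) (hc0 : c ≠ 0)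
    (hcgen : c ∉ minGens S) (hr : r ≠ 0) (hg : g = v + r • c) : g ∉ minGens S := by
  obtain ⟨r, rfl⟩ := Nat.exists_eq_succ_of_ne_zero hr
  rw [succ_nsmul, ← add_assoc] at hg
  intro hgen
  have hsum : v + r • c = 0 :=
    (hgen.2.2 _ (add_mem hv (nsmul_mem hc r)) c hc hg).resolve_right hc0
  rw [hsum, zero_add] at hg
  exact hcgen (hg ▸ hgen)

lemma exists_lt_exists_eq_add (hfg : S.FG) {x : ℕ → M} (hx : ∀ n, x n ∈ S) :
    ∃ m n, m < n ∧ ∃ s ∈ S, x n = x m + s := by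
  obtain ⟨A, rfl⟩ := hfg
  choose c _ hc using fun n ↦ AddSubmonoid.mem_closure_finset.mp (hx n)
  obtain ⟨m, n, hmn, hle⟩ := wellQuasiOrdered_le (fun n (g : A) ↦ c n g.1)
  refine ⟨m, n, hmn, ∑ g ∈ A, (c n g - c m g) • g,
    sum_mem fun g hg ↦ nsmul_mem (AddSubmonoid.subset_closure hg) _, ?_⟩
  rw [← hc, ← hc, ← Finset.sum_add_distrib]
  refine Finset.sum_congr rfl fun g hg ↦ ?_
  rw [← add_smul, Nat.add_sub_cancel' (hle ⟨g, hg⟩)]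

section Ordered

variable [PartialOrder M] [IsOrderedCancelAddMonoid M] [CanonicallyOrderedAdd M] [WellFoundedLT M]

lemma closure_minGens (S : AddSubmonoid M) : AddSubmonoid.closure (minGens S) = S := by
  refine le_antisymm (AddSubmonoid.closure_le.mpr fun x hx ↦ hx.1) fun x hx ↦ ?_
  induction x using WellFoundedLT.induction with
  | ind x ih =>
    by_cases hgen : x ∈ minGens S
    · exact AddSubmonoid.subset_closure hgen
    by_cases hx0 : x = 0
    · exact hx0 ▸ zero_mem _
    obtain ⟨b, hb, c, hc, rfl, hb0, hc0⟩ :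
        ∃ b ∈ S, ∃ c ∈ S, x = b + c ∧ b ≠ 0 ∧ c ≠ 0 := by
      by_contra! h
      exact hgen ⟨hx, hx0, fun b hb c hc hbc ↦ or_iff_not_imp_left.mpr (h b hb c hc hbc)⟩
    exact add_mem (ih b (lt_add_of_pos_right b (pos_iff_ne_zero.mpr hc0)) hb)
      (ih c (lt_add_of_pos_left c (pos_iff_ne_zero.mpr hb0)) hc)

lemma nonempty_minGens {x : M} (hx : x ∈ S) (hx0 : x ≠ 0) : (minGens S).Nonempty := by
  refine Set.nonempty_iff_ne_empty.mpr fun h ↦ hx0 ?_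
  rwa [← closure_minGens S, h, AddSubmonoid.closure_empty, AddSubmonoid.mem_bot] at hx

end Ordered

end MinimalGenerators

section PseudoFrobenius

variable {d : ℕ} {S : AddSubmonoid (Fin d → ℕ)}

lemma PF_bot : PF (⊥ : AddSubmonoid (Fin d → ℕ)) = ∅ := by
  refine Set.eq_empty_of_forall_notMem fun f hf ↦ hf.1.2 (AddSubmonoid.mem_bot.mpr ?_)
  have hcone : cone (⊥ : AddSubmonoid (Fin d → ℕ)) = ⊥ := by
    refine Submodule.span_eq_bot.mpr ?_
    rintro _ ⟨x, hx, rfl⟩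
    ext i
    rw [AddSubmonoid.mem_bot.mp hx]
    exact Nat.cast_zero
  have hf0 := hf.1.1
  rw [hcone, Submodule.mem_bot] at hf0
  ext i
  exact Nat.cast_eq_zero.mp (congrFun hf0 i)

lemma exists_mem_ne_zero_of_mem_PF {f : Fin d → ℕ} (hf : f ∈ PF S) : ∃ a ∈ S, a ≠ 0 := by
  refine S.bot_or_exists_ne_zero.resolve_left ?_
  rintro rfl
  exact (PF_bot ▸ hf : f ∈ (∅ : Set (Fin d → ℕ)))

theorem finite_PF (hfg : S.FG) : (PF S).Finite := by
  by_contra hinf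
  let f := Set.Infinite.natEmbedding (PF S) hinf
  obtain ⟨a, haS, ha0⟩ := exists_mem_ne_zero_of_mem_PF (f 0).2
  obtain ⟨m, n, hmn, s, hs, heq⟩ :=
    exists_lt_exists_eq_add hfg (fun n ↦ (f n).2.2 a haS ha0)
  rw [add_right_comm] at heq
  have hfs : (f n).1 = (f m).1 + s := add_right_cancel heq
  refine (f n).2.1.2 (hfs ▸ (f m).2.2 s hs ?_)
  rintro rfl
  rw [add_zero] at hfs
  exact hmn.ne (f.injective (Subtype.ext hfs)).symm

lemma mem_cone_of_axes {S : AddSubmonoid (Fin 2 → ℕ)} {c e : ℕ} (hc : c ≠ 0) (he : e ≠ 0)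
    (h₁ : ![c, 0] ∈ S) (h₂ : ![0, e] ∈ S) (f : Fin 2 → ℕ) : (fun i ↦ (f i : ℚ)) ∈ cone S := by
  have hf : (fun i ↦ (f i : ℚ)) = (f 0 / c : ℚ≥0) • (fun i ↦ ((![c, 0] : Fin 2 → ℕ) i : ℚ)) +
      (f 1 / e : ℚ≥0) • (fun i ↦ ((![0, e] : Fin 2 → ℕ) i : ℚ)) := by
    ext i
    fin_cases i
    · simp [NNRat.smul_def, hc]
    · simp [NNRat.smul_def, he]
  rw [hf]
  exact add_mem (Submodule.smul_mem _ _ (Submodule.subset_span ⟨_, h₁, rfl⟩))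
    (Submodule.smul_mem _ _ (Submodule.subset_span ⟨_, h₂, rfl⟩))

end PseudoFrobenius

section HomologicalAlgebra

open CategoryTheory Abelian Polynomial TensorProduct

lemma hasProjectiveDimensionLE_baseChange {A B : Type u} [CommRing A] [CommRing B] [Algebra A B]
    [Module.Flat A B] (n : ℕ) (M : Type u) [AddCommGroup M] [Module A M]
    (h : HasProjectiveDimensionLE (ModuleCat.of A M) n) :
    HasProjectiveDimensionLE (ModuleCat.of B (B ⊗[A] M)) n := by
  induction n generalizing M with
  | zero =>
    simp only [HasProjectiveDimensionLE, zero_add] at h ⊢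
    rw [← projective_iff_hasProjectiveDimensionLT_one, ← IsProjective.iff_projective] at h ⊢
    infer_instance
  | succ n ih =>
    obtain ⟨P, _, _, _, f, hf⟩ : ∃ (P : Type u) (_ : AddCommGroup P) (_ : Module A P)
        (_ : Module.Projective A P) (f : P →ₗ[A] M), Function.Surjective f :=
      ⟨M →₀ A, inferInstance, inferInstance, inferInstance, _,
        Finsupp.linearCombination_id_surjective A M⟩
    have hker : HasProjectiveDimensionLE (ModuleCat.of A (LinearMap.ker f)) n :=
      ((LinearMap.shortExact_shortComplexKer hf).hasProjectiveDimensionLT_X₃_iff n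
        ((IsProjective.iff_projective _).mp (inferInstanceAs (Module.Projective A P)))).mp h
    have hexact : Function.Exact ((LinearMap.ker f).subtype.baseChange B) (f.baseChange B) :=
      lTensor_exact B f.exact_subtype_ker_map hf
    have hshort := ModuleCat.shortComplex_shortExact
      (ModuleCat.shortComplexOfCompEqZero _ _ hexact.linearMap_comp_eq_zero) hexact
      (Module.Flat.lTensor_preserves_injective_linearMap _ (LinearMap.ker f).injective_subtype)
      (LinearMap.lTensor_surjective B hf)
    exact (hshort.hasProjectiveDimensionLT_X₃_iff n ((IsProjective.iff_projective _).mp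
      (inferInstanceAs (Module.Projective B (B ⊗[A] P))))).mpr (ih _ hker)

section PolynomialModule

variable (A M : Type*) [CommRing A] [AddCommGroup M] [Module A M]

lemma polynomialModule_single_eq_X_pow_smul (i : ℕ) (m : M) :
    PolynomialModule.single A i m = (X ^ i : A[X]) • PolynomialModule.single A 0 m := by
  rw [← monomial_one_right_eq_X_pow, PolynomialModule.monomial_smul_single, add_zero, one_smul]

lemma coeff_polynomialModule_map (f : M →ₗ[A] M) (z : PolynomialModule A M) (i : ℕ) :
    (PolynomialModule.map A f z).coeff i = f (z.coeff i) := by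
  induction z using PolynomialModule.induction_linear with
  | zero => simp
  | add p q hp hq => simp [hp, hq]
  | single j m =>
    simp only [PolynomialModule.map_single, PolynomialModule.coeff_single, Finsupp.single_apply]
    split_ifs <;> simp

variable [Module A[X] M] [IsScalarTower A A[X] M]

/-- The evaluation map `A[X] ⊗ M → M`, `∑ Xⁱ ⊗ mᵢ ↦ ∑ Xⁱ • mᵢ`, of an `A[X]`-module `M`, with
`PolynomialModule A M` in the role of `A[X] ⊗ M`. -/
def evalX : PolynomialModule A M →ₗ[A[X]] M :=
  (LinearMap.liftBaseChange A[X] (LinearMap.id : M →ₗ[A] M)).comp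
    (PolynomialModule.polynomialTensorProductLEquivPolynomialModule A M).symm.toLinearMap

lemma evalX_single_zero (m : M) : evalX A M (PolynomialModule.single A 0 m) = m := by
  have hsymm : (PolynomialModule.polynomialTensorProductLEquivPolynomialModule A M).symm
      (PolynomialModule.single A 0 m) = (1 : A[X]) ⊗ₜ[A] m := by
    rw [LinearEquiv.symm_apply_eq]
    change _ = LinearMap.liftBaseChange A[X] (PolynomialModule.lsingle A 0) _
    rw [LinearMap.liftBaseChange_tmul, one_smul]
    rfl
  simp [evalX, hsymm]

lemma evalX_single (i : ℕ) (m : M) :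
    evalX A M (PolynomialModule.single A i m) = (X ^ i : A[X]) • m := by
  rw [polynomialModule_single_eq_X_pow_smul, map_smul, evalX_single_zero]

/-- The difference `X ⊗ 1 - 1 ⊗ X` of the two actions of `X` on `A[X] ⊗ M`, whose cokernel is
`M`. -/
def subX : PolynomialModule A M →ₗ[A[X]] PolynomialModule A M where
  toFun z :=
    (X : A[X]) • z - PolynomialModule.map A ((LinearMap.lsmul A[X] M X).restrictScalars A) z
  map_add' x y := by simp only [smul_add, map_add]; abel
  map_smul' p x := by
    rw [PolynomialModule.map_smul, Algebra.algebraMap_self, Polynomial.map_id]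
    simp only [RingHom.id_apply, smul_sub, smul_smul, mul_comm]

lemma coeff_subX_succ (z : PolynomialModule A M) (i : ℕ) :
    (subX A M z).coeff (i + 1) = z.coeff i - (X : A[X]) • z.coeff (i + 1) := by
  have hshift : ((X : A[X]) • z).coeff (i + 1) = z.coeff i := by
    rw [← monomial_one_one_eq_X, PolynomialModule.monomial_smul_apply]; simp
  change ((X : A[X]) • z).coeff (i + 1) - (PolynomialModule.map A _ z).coeff (i + 1) = _
  rw [hshift, coeff_polynomialModule_map]
  rfl

lemma subX_single (i : ℕ) (m : M) :
    subX A M (PolynomialModule.single A i m) =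
      PolynomialModule.single A (i + 1) m - PolynomialModule.single A i ((X : A[X]) • m) := by
  change (X : A[X]) • PolynomialModule.single A i m - PolynomialModule.map A _ _ = _
  rw [PolynomialModule.map_single, ← monomial_one_one_eq_X, PolynomialModule.monomial_smul_single,
    one_smul, add_comm]
  rfl

lemma subX_injective : Function.Injective (subX A M) := by
  rw [injective_iff_map_eq_zero]
  intro z hz
  have hstep (i : ℕ) : z.coeff i = (X : A[X]) • z.coeff (i + 1) := by
    simpa [hz, eq_comm (a := (0 : M)), sub_eq_zero] using coeff_subX_succ A M z i
  have hiterate (i j : ℕ) : z.coeff i = (X ^ j : A[X]) • z.coeff (i + j) := by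
    induction j with
    | zero => simp
    | succ j ih => rw [ih, hstep, smul_smul, ← pow_succ, add_assoc]
  obtain ⟨N, hN⟩ := z.coeff.support.bddAbove
  rw [← PolynomialModule.coeff_eq_zero]
  ext i
  have hzero : z.coeff (i + (N + 1)) = 0 := by
    by_contra hne
    have := hN (Finset.mem_coe.mpr (Finsupp.mem_support_iff.mpr hne))
    omega
  rw [hiterate i (N + 1), hzero, smul_zero, Finsupp.zero_apply]

lemma evalX_subX (z : PolynomialModule A M) : evalX A M (subX A M z) = 0 := by
  induction z using PolynomialModule.induction_linear with
  | zero => simp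
  | add p q hp hq => simp [hp, hq]
  | single i m =>
    rw [subX_single, map_sub, evalX_single, evalX_single, smul_smul, pow_succ, sub_self]

lemma sub_single_evalX_mem_range_subX (z : PolynomialModule A M) :
    z - PolynomialModule.single A 0 (evalX A M z) ∈ LinearMap.range (subX A M) := by
  induction z using PolynomialModule.induction_linear with
  | zero => simp
  | add p q hp hq =>
    rw [map_add, PolynomialModule.single_add, add_sub_add_comm]
    exact add_mem hp hq
  | single i m =>
    rw [evalX_single]
    induction i generalizing m with
    | zero => simp
    | succ i ih =>
      have := add_mem (LinearMap.mem_range_self (subX A M) (PolynomialModule.single A i m))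
        (ih ((X : A[X]) • m))
      rwa [subX_single, sub_add_sub_cancel, smul_smul, ← pow_succ] at this

lemma exact_subX_evalX : Function.Exact (subX A M) (evalX A M) := by
  refine fun z ↦ ⟨fun h ↦ ?_, ?_⟩
  · simpa [h] using sub_single_evalX_mem_range_subX A M z
  · rintro ⟨y, rfl⟩
    exact evalX_subX A M y

lemma evalX_surjective : Function.Surjective (evalX A M) :=
  fun m ↦ ⟨_, evalX_single_zero A M m⟩

end PolynomialModule

lemma hasProjectiveDimensionLE_polynomial {A : Type u} [CommRing A] (n : ℕ)
    (M : Type u) [AddCommGroup M] [Module A M] [Module A[X] M] [IsScalarTower A A[X] M]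
    (h : HasProjectiveDimensionLE (ModuleCat.of A M) n) :
    HasProjectiveDimensionLE (ModuleCat.of A[X] M) (n + 1) := by
  have hextend : HasProjectiveDimensionLE (ModuleCat.of A[X] (PolynomialModule A M)) n :=
    have := hasProjectiveDimensionLE_baseChange (B := A[X]) n M h
    hasProjectiveDimensionLT_of_iso
      (PolynomialModule.polynomialTensorProductLEquivPolynomialModule A M).toModuleIso (n + 1)
  have hexact := exact_subX_evalX A M
  have hshort := ModuleCat.shortComplex_shortExact
    (ModuleCat.shortComplexOfCompEqZero _ _ hexact.linearMap_comp_eq_zero) hexact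
    (subX_injective A M) (evalX_surjective A M)
  exact hshort.hasProjectiveDimensionLT_X₃ (n + 1) hextend
    (hasProjectiveDimensionLT_of_ge _ (n + 1) _ (by omega))

lemma hasProjectiveDimensionLE_of_ringEquiv {R R' : Type u} [CommRing R] [CommRing R']
    (e : R ≃+* R') (M : Type u) [AddCommGroup M] [Module R M] [Module R' M]
    (he : ∀ (r : R) (m : M), e r • m = r • m) (n : ℕ)
    (_ : HasProjectiveDimensionLE (ModuleCat.of R M) n) :
    HasProjectiveDimensionLE (ModuleCat.of R' M) n :=
  have := RingHomInvPair.of_ringEquiv e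
  have := RingHomInvPair.of_ringEquiv e.symm
  ModuleCat.hasProjectiveDimensionLE_of_semiLinearEquiv
    (M := ModuleCat.of R M) (N := ModuleCat.of R' M) e
    { AddEquiv.refl M with map_smul' := fun r m ↦ (he r m).symm } n

lemma isScalarTower_compHom {A R R' M : Type*} [CommRing A] [CommRing R] [CommRing R']
    [Algebra A R] [Algebra A R'] [AddCommGroup M] [Module A M] [Module R' M] [IsScalarTower A R' M]
    (φ : R →ₐ[A] R') :
    letI := Module.compHom M φ.toRingHom
    IsScalarTower A R M := by
  let := Module.compHom M φ.toRingHom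
  refine .of_algebraMap_smul fun a m ↦ ?_
  change φ (algebraMap A R a) • m = a • m
  rw [φ.commutes, algebraMap_smul]

lemma hasProjectiveDimensionLE_mvPolynomial {A : Type u} [CommRing A] (n : ℕ)
    (τ : Type) [Finite τ] (M : Type u) [AddCommGroup M] [Module A M] [Module (MvPolynomial τ A) M]
    [IsScalarTower A (MvPolynomial τ A) M]
    (h : HasProjectiveDimensionLE (ModuleCat.of A M) n) :
    HasProjectiveDimensionLE (ModuleCat.of (MvPolynomial τ A) M) (n + Nat.card τ) := by
  revert M
  induction τ using Finite.induction_empty_option with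
  | @of_equiv σ τ e ih =>
    intro M _ _ _ _ h
    let φ := MvPolynomial.renameEquiv A e
    let := Module.compHom M φ.toAlgHom.toRingHom
    have := isScalarTower_compHom (M := M) φ.toAlgHom
    rw [← Nat.card_congr e]
    exact hasProjectiveDimensionLE_of_ringEquiv φ.toRingEquiv M (fun _ _ ↦ rfl) _ (ih M h)
  | h_empty =>
    intro M _ _ _ _ h
    rw [Nat.card_eq_zero.mpr (.inl inferInstance), add_zero]
    exact hasProjectiveDimensionLE_of_ringEquiv (MvPolynomial.isEmptyRingEquiv A PEmpty).symm M
      (algebraMap_smul (MvPolynomial PEmpty A)) n h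
  | @h_option τ _ ih =>
    intro M _ _ _ _ h
    let e := (MvPolynomial.optionEquivLeft A τ).symm
    let ι := IsScalarTower.toAlgHom A (MvPolynomial τ A) (MvPolynomial τ A)[X]
    let := Module.compHom M e.toAlgHom.toRingHom
    let := Module.compHom M (e.toAlgHom.comp ι).toRingHom
    have := isScalarTower_compHom (M := M) (e.toAlgHom.comp ι)
    have : IsScalarTower (MvPolynomial τ A) (MvPolynomial τ A)[X] M :=
      .of_algebraMap_smul fun _ _ ↦ rfl
    rw [Finite.card_option, ← add_assoc]
    exact hasProjectiveDimensionLE_of_ringEquiv e.toRingEquiv M (fun _ _ ↦ rfl) _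
      (hasProjectiveDimensionLE_polynomial _ M (ih M h))

lemma nontrivial_ext_of_linearEquiv {R : Type u} [CommRing R] {M N : Type u} [AddCommGroup M]
    [Module R M] [AddCommGroup N] [Module R N] (e : M ≃ₗ[R] N) {K : ModuleCat.{u} R} {n : ℕ}
    (h : Nontrivial (Ext (ModuleCat.of R M) K n)) : Nontrivial (Ext (ModuleCat.of R N) K n) :=
  have : Nontrivial (((extFunctor n).flip.obj K).obj (.op (ModuleCat.of R M))) := h
  (((extFunctor n).flip.obj K).mapIso e.toModuleIso.op).addCommGroupIsoToAddEquiv.nontrivial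

-- As `x` kills `K`, it acts as `0` on `Ext L K n`, so the connecting map is injective.
lemma nontrivial_ext_X₃ {R : Type u} [CommRing R] {L N K : ModuleCat.{u} R} {x : R}
    {g : L ⟶ N} {w : (x • 𝟙 L) ≫ g = 0} (hS : (ShortComplex.mk (x • 𝟙 L) g w).ShortExact)
    (hK : ∀ m : K, x • m = 0) {n : ℕ} (h : Nontrivial (Ext L K n)) :
    Nontrivial (Ext N K (n + 1)) := by
  obtain ⟨e, he⟩ := exists_ne (0 : Ext L K n)
  refine nontrivial_of_ne (hS.extClass.comp e (add_comm 1 n)) 0 fun hzero ↦ he ?_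
  obtain ⟨e', rfl⟩ := Ext.contravariant_sequence_exact₁ hS _ e (add_comm 1 n) hzero
  have hsmul : x • 𝟙 K = 0 := by
    ext m
    exact hK m
  change (Ext.mk₀ (x • 𝟙 L)).comp e' _ = 0
  rw [Ext.mk₀_smul, Ext.smul_comp, Ext.mk₀_id_comp, Ext.smul_eq_comp_mk₀, hsmul, Ext.mk₀_zero,
    Ext.comp_zero]

lemma nontrivial_ext_quotSMulTop {R : Type u} [CommRing R] {M : Type u} [AddCommGroup M]
    [Module R M] {K : ModuleCat.{u} R} {x : R} (hx : IsSMulRegular M x) (hK : ∀ m : K, x • m = 0)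
    {n : ℕ} (h : Nontrivial (Ext (ModuleCat.of R M) K n)) :
    Nontrivial (Ext (ModuleCat.of R (QuotSMulTop x M)) K (n + 1)) :=
  nontrivial_ext_X₃ (IsSMulRegular.smulShortComplex_shortExact (M := ModuleCat.of R M) hx) hK h

lemma nontrivial_ext_quotient_ofList {R : Type u} [CommRing R] {M : Type u} [AddCommGroup M]
    [Module R M] {K : ModuleCat.{u} R} {rs : List R}
    (hrs : RingTheory.Sequence.IsWeaklyRegular M rs) (hK : ∀ r ∈ rs, ∀ m : K, r • m = 0)
    {n : ℕ} (h : Nontrivial (Ext (ModuleCat.of R M) K n)) :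
    Nontrivial (Ext (ModuleCat.of R (M ⧸ Ideal.ofList rs • (⊤ : Submodule R M))) K
      (n + rs.length)) := by
  induction rs generalizing M n with
  | nil =>
    refine nontrivial_ext_of_linearEquiv (Submodule.quotEquivOfEqBot _ ?_).symm h
    rw [Ideal.ofList_nil, Submodule.bot_smul]
  | cons x rs ih =>
    rw [RingTheory.Sequence.isWeaklyRegular_cons_iff] at hrs
    rw [List.forall_mem_cons] at hK
    rw [List.length_cons, add_comm rs.length, ← add_assoc]
    exact nontrivial_ext_of_linearEquiv
      (Submodule.quotOfListConsSMulTopEquivQuotSMulTopInner M x rs).symm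
      (ih hrs.2 hK.2 (nontrivial_ext_quotSMulTop hrs.1 hK.1 h))

lemma ofList_map_X_smul_top {σ R : Type*} [CommRing R] (l : List σ) :
    Ideal.ofList (l.map (MvPolynomial.X : σ → MvPolynomial σ R)) •
      (⊤ : Submodule (MvPolynomial σ R) (MvPolynomial σ R)) =
      Ideal.span ((MvPolynomial.X : σ → MvPolynomial σ R) '' {i | i ∈ l}) := by
  rw [smul_eq_mul, Ideal.mul_top]
  simp [Ideal.ofList, Set.image]

lemma isWeaklyRegular_map_X {σ R : Type*} [CommRing R] {l : List σ} (hl : l.Nodup) :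
    RingTheory.Sequence.IsWeaklyRegular (MvPolynomial σ R)
      (l.map (MvPolynomial.X : σ → MvPolynomial σ R)) := by
  induction l using List.reverseRecOn with
  | nil => exact .nil _ _
  | append_singleton l j ih =>
    rw [List.map_append, List.map_singleton, RingTheory.Sequence.isWeaklyRegular_append_iff,
      RingTheory.Sequence.isWeaklyRegular_singleton_iff]
    refine ⟨ih (List.nodup_append.mp hl).1, isSMulRegular_iff_right_eq_zero_of_smul.mpr ?_⟩
    have hj : j ∉ l := fun hj ↦ (List.nodup_append.mp hl).2.2 j hj j (List.mem_singleton_self j) rfl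
    have hmem (p : MvPolynomial σ R) :
        p ∈ Ideal.ofList (l.map (MvPolynomial.X : σ → MvPolynomial σ R)) •
        (⊤ : Submodule (MvPolynomial σ R) (MvPolynomial σ R)) ↔
        ∀ m ∈ p.support, ∃ i ∈ l, m i ≠ 0 := by
      rw [ofList_map_X_smul_top]
      exact MvPolynomial.mem_ideal_span_X_image
    rintro ⟨p⟩ hp
    refine (Submodule.Quotient.mk_eq_zero _).mpr ((hmem p).mpr fun m hm ↦ ?_)
    obtain ⟨i, hil, hi⟩ := (hmem _).mp ((Submodule.Quotient.mk_eq_zero _).mp hp)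
      (Finsupp.single j 1 + m) (by
        refine MvPolynomial.mem_support_iff.mpr ?_
        change MvPolynomial.coeff _ (MvPolynomial.X j * p) ≠ 0
        rw [MvPolynomial.coeff_X_mul]
        exact MvPolynomial.mem_support_iff.mp hm)
    refine ⟨i, hil, ?_⟩
    rwa [Finsupp.add_apply, Finsupp.single_eq_of_ne (by rintro rfl; exact hj hil), zero_add] at hi

lemma mem_idealOfVars_iff_constantCoeff_eq_zero {σ R : Type*} [CommRing R]
    {p : MvPolynomial σ R} :
    p ∈ MvPolynomial.idealOfVars σ R ↔ MvPolynomial.constantCoeff p = 0 := by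
  rw [← pow_one (MvPolynomial.idealOfVars σ R), MvPolynomial.mem_pow_idealOfVars_iff']
  simp [Finsupp.degree_eq_zero_iff, MvPolynomial.constantCoeff_eq]

lemma not_hasProjectiveDimensionLT_quotient_idealOfVars {σ : Type} [Finite σ] {A : Type u}
    [CommRing A] [Nontrivial A] :
    ¬ HasProjectiveDimensionLT
      (ModuleCat.of (MvPolynomial σ A) (MvPolynomial σ A ⧸ MvPolynomial.idealOfVars σ A))
      (Nat.card σ) := by
  intro h
  have := Fintype.ofFinite σ
  let R := MvPolynomial σ A
  let K := ModuleCat.of R (R ⧸ MvPolynomial.idealOfVars σ A)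
  let rs : List R := Finset.univ.toList.map (MvPolynomial.X : σ → R)
  have : Nontrivial K := Ideal.Quotient.nontrivial_iff.mpr <| (Ideal.ne_top_iff_one _).mpr <| by
    simp [mem_idealOfVars_iff_constantCoeff_eq_zero]
  have hhom : Nontrivial (Ext (ModuleCat.of R R) K 0) := by
    obtain ⟨m, hm⟩ := exists_ne (0 : K)
    refine nontrivial_of_ne (Ext.mk₀ (ModuleCat.ofHom (LinearMap.toSpanSingleton R K m))) 0 ?_
    rw [Ne, Ext.mk₀_eq_zero_iff]
    intro hzero
    have hone : LinearMap.toSpanSingleton R K m 1 = 0 := congrArg (fun φ ↦ φ.hom (1 : R)) hzero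
    exact hm (by rwa [LinearMap.toSpanSingleton_apply, one_smul] at hone)
  have hK (r) (hr : r ∈ rs) (m : K) : r • m = 0 := by
    obtain ⟨i, -, rfl⟩ := List.mem_map.mp hr
    obtain ⟨p, rfl⟩ := Submodule.Quotient.mk_surjective _ m
    exact (Submodule.Quotient.mk_eq_zero _).mpr
      (Ideal.mul_mem_right _ _ (Ideal.subset_span ⟨i, rfl⟩))
  have hideal : Ideal.ofList rs • (⊤ : Submodule R R) = MvPolynomial.idealOfVars σ A := by
    rw [ofList_map_X_smul_top, MvPolynomial.idealOfVars, ← Set.image_univ]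
    simp
  have hext := nontrivial_ext_of_linearEquiv (Submodule.quotEquivOfEq _ _ hideal)
    (nontrivial_ext_quotient_ofList (isWeaklyRegular_map_X (Finset.nodup_toList _)) hK hhom)
  have hlength : 0 + rs.length = Nat.card σ := by simp [rs]
  rw [hlength] at hext
  obtain ⟨e, he⟩ := exists_ne (0 : Ext K K (Nat.card σ))
  exact he (e.eq_zero_of_hasProjectiveDimensionLT (Nat.card σ) le_rfl)

lemma bijective_iterate_compl_range {ι : Type*} {s : ι → ι} (hs : Function.Injective s)
    {deg : ι → ℕ} (hdeg : ∀ i, deg i < deg (s i)) :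
    Function.Bijective fun x : ℕ × ↥(Set.range s)ᶜ ↦ s^[x.1] x.2 := by
  refine ⟨?_, fun i ↦ ?_⟩
  · suffices h : ∀ (j l : ℕ) (w w' : ↥(Set.range s)ᶜ), s^[j] w = s^[l] w' → j = l ∧ w = w' from
      fun x y hxy ↦ Prod.ext_iff.mpr (h x.1 y.1 x.2 y.2 hxy)
    intro j
    induction j with
    | zero =>
      rintro (_ | l) w w' h
      · exact ⟨rfl, Subtype.ext h⟩
      · exact absurd ⟨_, (h.trans (Function.iterate_succ_apply' s l w')).symm⟩ w.2
    | succ j ih =>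
      rintro (_ | l) w w' h
      · exact absurd ⟨_, (Function.iterate_succ_apply' s j w).symm.trans h⟩ w'.2
      · rw [Function.iterate_succ_apply', Function.iterate_succ_apply'] at h
        exact (ih l w w' (hs h)).imp_left (congrArg (· + 1))
  · induction hd : deg i using Nat.strong_induction_on generalizing i with
    | _ d ih =>
      by_cases hi : i ∈ Set.range s
      · obtain ⟨i', rfl⟩ := hi
        obtain ⟨⟨j, w⟩, rfl⟩ := ih _ (hd ▸ hdeg i') i' rfl
        exact ⟨(j + 1, w), Function.iterate_succ_apply' s j w⟩
      · exact ⟨(0, ⟨i, hi⟩), rfl⟩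

lemma free_polynomial_of_basis_shift {k M ι : Type*} [CommRing k] [AddCommGroup M] [Module k M]
    [Module k[X] M] [IsScalarTower k k[X] M] (b : Module.Basis ι k M) {s : ι → ι}
    (hs : Function.Injective s) (hX : ∀ i, (X : k[X]) • b i = b (s i)) {deg : ι → ℕ}
    (hdeg : ∀ i, deg i < deg (s i)) : Module.Free k[X] M := by
  let W := ↥(Set.range s)ᶜ
  let c : Module.Basis (ℕ × W) k (W →₀ k[X]) :=
    (Polynomial.basisMonomials k).smulTower (Finsupp.basisSingleOne : Module.Basis W k[X] _)
  let L : (W →₀ k[X]) →ₗ[k[X]] M := Finsupp.linearCombination k[X] fun w : W ↦ b w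
  let e : (W →₀ k[X]) ≃ₗ[k] M :=
    c.equiv b (Equiv.ofBijective _ (bijective_iterate_compl_range hs hdeg))
  have hpow (j : ℕ) (i : ι) : (X ^ j : k[X]) • b i = b (s^[j] i) := by
    induction j with
    | zero => rw [pow_zero, one_smul, Function.iterate_zero_apply]
    | succ j ih => rw [pow_succ', mul_smul, ih, hX, Function.iterate_succ_apply']
  have hL : L.restrictScalars k = e.toLinearMap := by
    refine c.ext fun x ↦ ?_
    rw [LinearEquiv.coe_coe, Module.Basis.equiv_apply, Equiv.ofBijective_apply]
    simp [c, L, hpow, monomial_one_right_eq_X_pow]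
  have hbij : Function.Bijective L := by
    have : (L : (W →₀ k[X]) → M) = e := congrArg DFunLike.coe hL
    exact this ▸ e.bijective
  exact .of_equiv (LinearEquiv.ofBijective L hbij)

lemma hasProjectiveDimensionLT_card_of_basis_shift {σ : Type} [Finite σ] {k : Type u} [CommRing k]
    {M : Type u} [AddCommGroup M] [Module k M] [Module (MvPolynomial σ k) M]
    [IsScalarTower k (MvPolynomial σ k) M] {ι : Type*} (b : Module.Basis ι k M) {x : σ} {s : ι → ι}
    (hs : Function.Injective s) (hX : ∀ i, (MvPolynomial.X x : MvPolynomial σ k) • b i = b (s i))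
    {deg : ι → ℕ} (hdeg : ∀ i, deg i < deg (s i)) :
    HasProjectiveDimensionLT (ModuleCat.of (MvPolynomial σ k) M) (Nat.card σ) := by
  classical
  let τ := {y // y ≠ x}
  let e : MvPolynomial τ k[X] ≃ₐ[k] MvPolynomial σ k :=
    (MvPolynomial.optionEquivRight k τ).symm.trans
      (MvPolynomial.renameEquiv k (Equiv.optionSubtypeNe x))
  have heX : e (MvPolynomial.C X) = MvPolynomial.X x := by
    have : (MvPolynomial.optionEquivRight k τ).symm (MvPolynomial.C X) = MvPolynomial.X none := by
      rw [AlgEquiv.symm_apply_eq, MvPolynomial.optionEquivRight_X_none]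
    rw [AlgEquiv.trans_apply, this, MvPolynomial.renameEquiv_apply, MvPolynomial.rename_X,
      Equiv.optionSubtypeNe_none]
  let : Module (MvPolynomial τ k[X]) M := Module.compHom M e.toRingEquiv.toRingHom
  let : Module k[X] M := Module.compHom M (MvPolynomial.C : k[X] →+* MvPolynomial τ k[X])
  have : IsScalarTower k[X] (MvPolynomial τ k[X]) M := .of_algebraMap_smul fun _ _ ↦ rfl
  have : IsScalarTower k k[X] M :=
    isScalarTower_compHom (e.toAlgHom.comp (IsScalarTower.toAlgHom k k[X] (MvPolynomial τ k[X])))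
  have : Module.Free k[X] M := free_polynomial_of_basis_shift b hs (fun i ↦ by
    rw [← hX, ← heX]
    rfl) hdeg
  have hfree : HasProjectiveDimensionLE (ModuleCat.of k[X] M) 0 :=
    projective_iff_hasProjectiveDimensionLE_zero _ |>.mp
      ((IsProjective.iff_projective _).mp inferInstance)
  have hcard : Nat.card σ = 0 + Nat.card τ + 1 := by
    rw [← Nat.card_congr (Equiv.optionSubtypeNe x), Finite.card_option, zero_add]
  rw [hcard]
  exact hasProjectiveDimensionLE_of_ringEquiv e.toRingEquiv M (fun _ _ ↦ rfl) _
    (hasProjectiveDimensionLE_mvPolynomial 0 τ M hfree)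

section WeightedModule

variable (k : Type u) [CommRing k] {σ G : Type} [AddCancelCommMonoid G]

/-- The semigroup ring `k[G]`, regarded as a module over the polynomial ring `k[x_i : i ∈ σ]`, where
`x_i` acts as multiplication by `t ^ (w i)`. A type synonym is used because the action depends on
the weights `w`. -/
def WeightedModule (_ : σ → G) : Type u := AddMonoidAlgebra k G

variable {k} {w : σ → G}

instance : AddCommGroup (WeightedModule k w) :=
  inferInstanceAs (AddCommGroup (AddMonoidAlgebra k G))

instance : Module k (WeightedModule k w) :=
  inferInstanceAs (Module k (AddMonoidAlgebra k G))

instance : Module (MvPolynomial σ k) (WeightedModule k w) :=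
  Module.compHom (AddMonoidAlgebra k G)
    (MvPolynomial.aeval fun i ↦ AddMonoidAlgebra.single (w i) (1 : k)).toRingHom

instance : IsScalarTower k (MvPolynomial σ k) (WeightedModule k w) :=
  isScalarTower_compHom (M := AddMonoidAlgebra k G)
    (MvPolynomial.aeval fun i ↦ AddMonoidAlgebra.single (w i) (1 : k))

namespace WeightedModule

/-- The coefficients of an element of `WeightedModule k w`. -/
def coeff : WeightedModule k w ≃ₗ[k] (G →₀ k) := AddMonoidAlgebra.coeffLinearEquiv k

lemma smul_eq_aeval_mul (r : MvPolynomial σ k) (p : WeightedModule k w) :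
    (r • p : WeightedModule k w) =
      (MvPolynomial.aeval fun i ↦ AddMonoidAlgebra.single (w i) (1 : k)) r *
        (show AddMonoidAlgebra k G from p) := rfl

lemma X_smul_eq_single_mul (i : σ) (p : WeightedModule k w) :
    ((MvPolynomial.X i : MvPolynomial σ k) • p : WeightedModule k w) =
      AddMonoidAlgebra.single (w i) (1 : k) * (show AddMonoidAlgebra k G from p) := by
  rw [smul_eq_aeval_mul, MvPolynomial.aeval_X]

lemma X_smul_coeff_symm_single (i : σ) (g : G) (c : k) :
    (MvPolynomial.X i : MvPolynomial σ k) • (coeff.symm (Finsupp.single g c) : WeightedModule k w) =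
      coeff.symm (Finsupp.single (w i + g) c) := by
  rw [X_smul_eq_single_mul]
  exact (AddMonoidAlgebra.single_mul_single _ _ _ _).trans (by rw [one_mul]; rfl)

lemma coeff_X_smul_eq_zero {i : σ} {p : WeightedModule k w} {g : G}
    (h : ∀ g', w i + g' = g → p.coeff g' = 0) :
    ((MvPolynomial.X i : MvPolynomial σ k) • p).coeff g = 0 := by
  rw [X_smul_eq_single_mul]
  by_cases hg : ∃ g', w i + g' = g
  · obtain ⟨g', rfl⟩ := hg
    refine (AddMonoidAlgebra.coeff_single_mul_eq_mul_coeff g'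
      fun m _ ↦ add_right_inj (w i)).trans ?_
    rw [one_mul]
    exact h g' rfl
  · exact AddMonoidAlgebra.coeff_single_mul_of_forall_add_ne _ _ fun g' hg' ↦ hg ⟨g', hg'⟩

variable (k) in
/-- The submodule spanned by the monomials `t ^ g`, `g ∈ Y`, for a set `Y` that is stable under
adding the weights. -/
def supported (Y : Set G) (hY : ∀ i, ∀ g ∈ Y, w i + g ∈ Y) :
    Submodule (MvPolynomial σ k) (WeightedModule k w) where
  __ := ((Finsupp.supported k k Y).comap (coeff (w := w)).toLinearMap).toAddSubmonoid
  smul_mem' r p hp := by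
    change coeff p ∈ Finsupp.supported k k Y at hp
    change coeff (r • p) ∈ Finsupp.supported k k Y
    induction r using MvPolynomial.induction_on generalizing p with
    | C c =>
      rw [← MvPolynomial.algebraMap_eq, algebraMap_smul, map_smul]
      exact Submodule.smul_mem _ _ hp
    | add r s hr hs =>
      rw [add_smul, map_add]
      exact add_mem (hr p hp) (hs p hp)
    | mul_X r i hr =>
      rw [mul_smul]
      refine hr _ ((Finsupp.mem_supported' _ _).mpr fun g hg ↦ coeff_X_smul_eq_zero ?_)
      rintro g' rfl
      exact (Finsupp.mem_supported' _ _).mp hp g' fun hg' ↦ hg (hY i g' hg')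

variable {Y : Set G} {hY : ∀ i, ∀ g ∈ Y, w i + g ∈ Y}

lemma mem_supported {p : WeightedModule k w} : p ∈ supported k Y hY ↔ ∀ g ∉ Y, p.coeff g = 0 :=
  Finsupp.mem_supported' k p.coeff

/-- The basis of `supported k Y hY` over `k` formed by the monomials `t ^ g`, `g ∈ Y`. -/
def supportedBasis : Module.Basis Y k (supported k Y hY) :=
  .ofRepr ((coeff.ofSubmodule' (Finsupp.supported k k Y)).trans (Finsupp.supportedEquivFinsupp Y))

lemma coe_supportedBasis (g : Y) : ((supportedBasis g : supported k Y hY) : WeightedModule k w) =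
    coeff.symm (Finsupp.single g.1 1) := by
  classical
  change coeff.symm ((Finsupp.supportedEquivFinsupp (R := k) Y).symm (Finsupp.single g 1)).1 = _
  rw [Finsupp.supportedEquivFinsupp_symm_single]

lemma hasProjectiveDimensionLT_supported [Finite σ] {i : σ} {deg : G → ℕ}
    (hdeg : ∀ g, deg g < deg (w i + g)) :
    HasProjectiveDimensionLT (ModuleCat.of (MvPolynomial σ k) (supported k Y hY)) (Nat.card σ) := by
  refine hasProjectiveDimensionLT_card_of_basis_shift supportedBasis
    (x := i) (s := fun g ↦ ⟨w i + g.1, hY i g.1 g.2⟩) (fun g g' h ↦ ?_) (fun g ↦ ?_)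
    (deg := fun g ↦ deg g.1) fun g ↦ hdeg g.1
  · exact Subtype.ext (add_left_cancel (congrArg Subtype.val h))
  · refine Subtype.ext ?_
    rw [Submodule.coe_smul, coe_supportedBasis, coe_supportedBasis, X_smul_coeff_symm_single]

/-- The coefficient at a point `f` that is not of the form `w i + g` with `g ∈ Y`, as a linear map
to the quotient of the polynomial ring by the ideal of the variables. -/
def coeffAt (f : G) (hf : ∀ i, ∀ g ∈ Y, w i + g ≠ f) :
    supported k Y hY →ₗ[MvPolynomial σ k]
      (MvPolynomial σ k ⧸ MvPolynomial.idealOfVars σ k) where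
  toFun p := Ideal.Quotient.mk _ (MvPolynomial.C (coeff p.1 f))
  map_add' p q := by simp only [Submodule.coe_add, map_add, Finsupp.add_apply]
  map_smul' r p := by
    rw [RingHom.id_apply]
    induction r using MvPolynomial.induction_on generalizing p with
    | C c =>
      rw [← MvPolynomial.algebraMap_eq, algebraMap_smul, Submodule.coe_smul_of_tower, map_smul,
        Finsupp.smul_apply, smul_eq_mul, map_mul, map_mul]
      rfl
    | add r s hr hs =>
      rw [add_smul, add_smul, ← hr, ← hs]
      simp only [Submodule.coe_add, map_add, Finsupp.add_apply]
    | mul_X r i hr =>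
      have hzero : coeff ((MvPolynomial.X i : MvPolynomial σ k) • p : supported k Y hY).1 f = 0 :=
        coeff_X_smul_eq_zero fun g hg ↦ mem_supported.mp p.2 g fun hgY ↦ hf i g hgY hg
      rw [mul_smul, hr, mul_smul, hzero, map_zero, map_zero]
      refine congrArg (r • ·) (Ideal.Quotient.eq_zero_iff_mem.mpr ?_).symm
      exact Ideal.mul_mem_right _ _ (Ideal.subset_span ⟨i, rfl⟩)

variable {f : G} {hf : ∀ i, ∀ g ∈ Y, w i + g ≠ f}

lemma coeffAt_apply (p : supported k Y hY) :
    coeffAt f hf p = Ideal.Quotient.mk _ (MvPolynomial.C (coeff p.1 f)) := rfl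

lemma coeffAt_eq_zero_iff {p : supported k Y hY} : coeffAt f hf p = 0 ↔ coeff p.1 f = 0 := by
  rw [coeffAt_apply, Ideal.Quotient.eq_zero_iff_mem, mem_idealOfVars_iff_constantCoeff_eq_zero,
    MvPolynomial.constantCoeff_C]

lemma coeffAt_surjective (hfY : f ∈ Y) :
    Function.Surjective (coeffAt f hf : supported k Y hY →ₗ[MvPolynomial σ k] _) := by
  have hone : coeffAt f hf (supportedBasis (k := k) (hY := hY) ⟨f, hfY⟩) =
      Ideal.Quotient.mk _ 1 := by
    rw [coeffAt_apply, coe_supportedBasis, LinearEquiv.apply_symm_apply, Finsupp.single_eq_same,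
      map_one]
  intro y
  obtain ⟨r, rfl⟩ := Ideal.Quotient.mk_surjective y
  refine ⟨r • supportedBasis ⟨f, hfY⟩, ?_⟩
  rw [map_smul, hone]
  exact congrArg (Ideal.Quotient.mk _) (mul_one r)

lemma supported_mono {Z : Set G} {hZ : ∀ i, ∀ g ∈ Z, w i + g ∈ Z} (h : Y ⊆ Z) :
    supported k Y hY ≤ supported k Z hZ :=
  fun _ hp ↦ mem_supported.mpr fun g hg ↦ mem_supported.mp hp g fun hgY ↦ hg (h hgY)

lemma exact_inclusion_coeffAt (hfY : f ∉ Y)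
    {hinsert : ∀ i, ∀ g ∈ insert f Y, w i + g ∈ insert f Y}
    {hf : ∀ i, ∀ g ∈ insert f Y, w i + g ≠ f} :
    Function.Exact (Submodule.inclusion (supported_mono (k := k) (hY := hY) (hZ := hinsert)
      (Set.subset_insert f Y))) (coeffAt f hf) := by
  refine LinearMap.exact_iff.mpr (Submodule.ext fun p ↦ ?_)
  rw [LinearMap.mem_ker, coeffAt_eq_zero_iff, Submodule.range_inclusion, Submodule.mem_comap,
    Submodule.subtype_apply, mem_supported]
  refine ⟨fun hpf g hg ↦ ?_, fun hp ↦ hp f hfY⟩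
  by_cases hgf : g = f
  · rwa [hgf]
  · exact mem_supported.mp p.2 g fun h ↦ h.elim hgf hg

theorem projectiveDimension_supported_add_one [Nontrivial k] [Finite σ] {i : σ} {deg : G → ℕ}
    (hdeg : ∀ g, deg g < deg (w i + g)) (hfY : f ∉ Y) (hwf : ∀ i, w i + f ∈ Y) :
    projectiveDimension (ModuleCat.of (MvPolynomial σ k) (supported k Y hY)) + 1 =
      (Nat.card σ : WithBot ℕ∞) := by
  have hinsert (i : σ) (g : G) (hg : g ∈ insert f Y) : w i + g ∈ Y := by
    rcases hg with rfl | hg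
    exacts [hwf i, hY i g hg]
  have hZ (i : σ) (g : G) (hg : g ∈ insert f Y) : w i + g ∈ insert f Y := .inr (hinsert i g hg)
  have hf (i : σ) (g : G) (hg : g ∈ insert f Y) : w i + g ≠ f :=
    fun h ↦ hfY (h ▸ hinsert i g hg)
  have hexact := exact_inclusion_coeffAt (k := k) (hY := hY) (hinsert := hZ) (hf := hf) hfY
  have hshort := ModuleCat.shortComplex_shortExact
    (ModuleCat.shortComplexOfCompEqZero _ _ hexact.linearMap_comp_eq_zero) hexact
    (Submodule.inclusion_injective (supported_mono (Set.subset_insert f Y)))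
    (coeffAt_surjective (hf := hf) (Set.mem_insert f Y))
  have hY_lt := hasProjectiveDimensionLT_supported (k := k) (hY := hY) hdeg
  have hZ_lt := hasProjectiveDimensionLT_supported (k := k) (hY := hZ) hdeg
  have hquot := not_hasProjectiveDimensionLT_quotient_idealOfVars (σ := σ) (A := k)
  obtain ⟨m, hm⟩ : ∃ m, Nat.card σ = m + 1 :=
    Nat.exists_eq_succ_of_ne_zero (Nat.card_ne_zero.mpr ⟨⟨i⟩, inferInstance⟩)
  rw [hm] at hY_lt hZ_lt hquot
  have hge : m ≤ projectiveDimension (ModuleCat.of (MvPolynomial σ k) (supported k Y hY)) :=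
    (projectiveDimension_ge_iff _ m).mpr fun h ↦
      hquot (hshort.hasProjectiveDimensionLT_X₃ m h hZ_lt)
  rw [le_antisymm ((projectiveDimension_le_iff _ m).mpr hY_lt) hge, hm]
  norm_cast

end WeightedModule

end WeightedModule

section MPD

variable {d : ℕ} (k : Type u) [Field k] (S : AddSubmonoid (Fin d → ℕ))

/-- The inclusion of `k[S]` into `k[ℕ^d]`. -/
def toWeightedModule : semigroupModule k S →ₗ[MvPolynomial (minGens S) k]
    WeightedModule k (fun a : minGens S ↦ a.1) where
  toFun p := AddMonoidAlgebra.mapDomain S.subtype (p : AddMonoidAlgebra k S)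
  map_add' p q := AddMonoidAlgebra.mapDomain_add _ _ _
  map_smul' r p := by
    change AddMonoidAlgebra.mapDomainAlgHom k k S.subtype
        (presentation k S r * (show AddMonoidAlgebra k S from p)) =
      (MvPolynomial.aeval fun i : minGens S ↦ AddMonoidAlgebra.single i.1 (1 : k)) r *
        AddMonoidAlgebra.mapDomainAlgHom k k S.subtype (show AddMonoidAlgebra k S from p)
    rw [map_mul, ← AlgHom.comp_apply]
    congr 2
    ext a
    simp [presentation]

lemma toWeightedModule_injective : Function.Injective (toWeightedModule k S) :=
  AddMonoidAlgebra.mapDomain_injective Subtype.val_injective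

lemma range_toWeightedModule : LinearMap.range (toWeightedModule k S) =
    WeightedModule.supported k S (fun i _ hg ↦ S.add_mem i.2.1 hg) := by
  ext p
  rw [WeightedModule.mem_supported]
  constructor
  · rintro ⟨q, rfl⟩ g hg
    refine Finsupp.mapDomain_of_notMem_range _ _ ?_
    rintro ⟨x, rfl⟩
    exact hg x.2
  · intro h
    obtain ⟨q, hq⟩ := (Finsupp.mem_range_mapDomain_iff S.subtype Subtype.val_injective p.coeff).mpr
      fun g hg ↦ h g fun hg' ↦ hg ⟨⟨g, hg'⟩, rfl⟩
    exact ⟨AddMonoidAlgebra.ofCoeff q, congrArg AddMonoidAlgebra.ofCoeff hq⟩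

variable {S}

theorem isMPD_of_PF_nonempty (hfg : S.FG) (hPF : (PF S).Nonempty) : IsMPD k S := by
  obtain ⟨f, hf⟩ := hPF
  obtain ⟨a, haS, ha0⟩ := exists_mem_ne_zero_of_mem_PF hf
  obtain ⟨x, hx⟩ := nonempty_minGens haS ha0
  have : Finite (minGens S) := finite_minGens hfg
  have hdeg (g : Fin d → ℕ) : ∑ i, g i < ∑ i, (x + g) i := by
    obtain ⟨i, hi⟩ := Function.ne_iff.mp hx.2.1
    exact Finset.sum_lt_sum (fun j _ ↦ Nat.le_add_left _ _)
      ⟨i, Finset.mem_univ i, Nat.lt_add_of_pos_left (Nat.pos_of_ne_zero hi)⟩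
  let e := (LinearEquiv.ofInjective _ (toWeightedModule_injective k S)).trans
      (LinearEquiv.ofEq _ _ (range_toWeightedModule k S))
  refine ⟨hfg, ?_⟩
  rw [projectiveDimension_eq_of_iso e.toModuleIso]
  exact WeightedModule.projectiveDimension_supported_add_one (i := ⟨x, hx⟩) hdeg hf.1.2
    fun i ↦ add_comm f i.1 ▸ hf.2 i.1 i.2.1 i.2.2.1

end MPD

end HomologicalAlgebra

section Gluing

variable {d m : ℕ} {S : AddSubmonoid (Fin d → ℕ)} {T : AddSubmonoid ℕ} {c : Fin d → ℕ}

/-- The semigroup generated by `m S` and by the multiples `t c`, `t ∈ T`, of a vector `c`. -/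
def lineGluing (S : AddSubmonoid (Fin d → ℕ)) (T : AddSubmonoid ℕ) (c : Fin d → ℕ) (m : ℕ) :
    AddSubmonoid (Fin d → ℕ) :=
  S.map (nsmulAddMonoidHom m) ⊔ T.map (multiplesHom _ c)

/-- The conditions under which `lineGluing S T c m` is the gluing of `m S` and `T c` by `m c`. The
field `modEq` says that `G(m S) ∩ ℤ c` is contained in `ℤ m c`, without leaving `ℕ ^ d`. -/
structure IsGluable (S : AddSubmonoid (Fin d → ℕ)) (T : AddSubmonoid ℕ) (c : Fin d → ℕ)
    (m : ℕ) : Prop where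
  vec_mem : c ∈ S
  vec_ne_zero : c ≠ 0
  vec_notMem_minGens : c ∉ minGens S
  mul_mem : m ∈ T
  mul_ne_zero : m ≠ 0
  mul_notMem_minGens : m ∉ minGens T
  modEq : ∀ u ∈ S, ∀ v ∈ S, ∀ s t : ℕ, m • u + s • c = m • v + t • c → s ≡ t [MOD m]

/-- The maximal elements of the Apéry set of `T` with respect to `m`, for the order in which
`x ≤ y` if `y ∈ x + T`. They are the `m + f` with `f` pseudo-Frobenius; for `T = ℕ` there is only
`m - 1`. -/
def maximalApery (T : AddSubmonoid ℕ) (m : ℕ) : Set ℕ :=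
  {x | x ∈ T ∧ x ∉ (m + ·) '' (T : Set ℕ) ∧ ∀ t ∈ T, t ≠ 0 → x + t ∈ (m + ·) '' (T : Set ℕ)}

lemma eq_zero_of_add_mul_notMem {t r : ℕ} (hm : m ∈ T) (ht : t ∈ T)
    (hr : t + r * m ∉ (m + ·) '' (T : Set ℕ)) : r = 0 := by
  by_contra hr0
  obtain ⟨r, rfl⟩ := Nat.exists_eq_add_one_of_ne_zero hr0
  exact hr ⟨t + r • m, add_mem ht (nsmul_mem hm r), by simp only [smul_eq_mul]; ring⟩

lemma image_numericalPF_subset_maximalApery (hm : m ∈ T) (hm0 : m ≠ 0) :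
    (m + ·) '' numericalPF T ⊆ maximalApery T m := by
  rintro _ ⟨f, ⟨hfT, hf_add⟩, rfl⟩
  refine ⟨by simpa only [add_comm m f] using hf_add m hm hm0, ?_, fun t ht ht0 ↦
    ⟨f + t, hf_add t ht ht0, (add_assoc m f t).symm⟩⟩
  rintro ⟨t, ht, heq⟩
  exact hfT (add_left_cancel heq ▸ ht)

lemma sub_one_mem_maximalApery_top (hm : m ≠ 0) : m - 1 ∈ maximalApery ⊤ m := by
  refine ⟨AddSubmonoid.mem_top _, ?_, fun t _ ht ↦ ⟨t - 1, AddSubmonoid.mem_top _, ?_⟩⟩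
  · rintro ⟨t, -, ht⟩
    dsimp only at ht
    omega
  · dsimp only
    omega

lemma mem_lineGluing_iff {x : Fin d → ℕ} :
    x ∈ lineGluing S T c m ↔ ∃ v ∈ S, ∃ t ∈ T, m • v + t • c = x := by
  simp only [lineGluing, AddSubmonoid.mem_sup, AddSubmonoid.mem_map, exists_exists_and_eq_and]
  rfl

lemma closure_nsmul_image_minGens (S : AddSubmonoid (Fin d → ℕ)) (m : ℕ) :
    AddSubmonoid.closure ((m • ·) '' minGens S) = S.map (nsmulAddMonoidHom m) := by
  conv_rhs => rw [← closure_minGens S, AddMonoidHom.map_mclosure]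
  rfl

lemma closure_image_nsmul_minGens (T : AddSubmonoid ℕ) (c : Fin d → ℕ) :
    AddSubmonoid.closure ((· • c) '' minGens T) = T.map (multiplesHom _ c) := by
  conv_rhs => rw [← closure_minGens T, AddMonoidHom.map_mclosure]
  rfl

lemma fg_lineGluing (hS : S.FG) (hT : T.FG) : (lineGluing S T c m).FG :=
  (hS.map _).sup (hT.map _)

lemma add_nsmul_mem_cone_lineGluing {f : Fin d → ℕ} {t : ℕ} (hm : m ≠ 0)
    (hf : (fun i ↦ (f i : ℚ)) ∈ cone S) (ht : t ∈ T) :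
    (fun i ↦ ((m • f + t • c) i : ℚ)) ∈ cone (lineGluing S T c m) := by
  have hle : cone S ≤ cone (lineGluing S T c m) := by
    refine Submodule.span_le.mpr ?_
    rintro _ ⟨v, hv, rfl⟩
    have hmv : m • v ∈ lineGluing S T c m :=
      mem_lineGluing_iff.mpr ⟨v, hv, 0, zero_mem T, by rw [zero_nsmul, add_zero]⟩
    have hv_eq : (fun i ↦ (v i : ℚ)) = (m : ℚ≥0)⁻¹ • fun i ↦ ((m • v) i : ℚ) := by
      ext i
      simp [NNRat.smul_def, hm]
    change (fun i ↦ (v i : ℚ)) ∈ cone (lineGluing S T c m)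
    rw [hv_eq]
    exact Submodule.smul_mem _ _ (Submodule.subset_span ⟨_, hmv, rfl⟩)
  have htc : t • c ∈ lineGluing S T c m :=
    mem_lineGluing_iff.mpr ⟨0, zero_mem S, t, ht, by rw [nsmul_zero, zero_add]⟩
  have hsum : (fun i ↦ ((m • f + t • c) i : ℚ)) =
      (m : ℚ≥0) • (fun i ↦ (f i : ℚ)) + fun i ↦ ((t • c) i : ℚ) := by
    ext i
    simp [NNRat.smul_def]
  rw [hsum]
  exact add_mem (Submodule.smul_mem _ _ (hle hf)) (Submodule.subset_span ⟨_, htc, rfl⟩)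

lemma exists_sub_of_mem_groupOf {x : Fin d → ℤ} (hx : x ∈ groupOf S) :
    ∃ u ∈ S, ∃ v ∈ S, x = (fun i ↦ (u i : ℤ)) - fun i ↦ (v i : ℤ) := by
  induction hx using AddSubgroup.closure_induction with
  | mem x hx =>
    obtain ⟨u, hu, rfl⟩ := hx
    exact ⟨u, hu, 0, zero_mem S, (sub_zero _).symm⟩
  | zero => exact ⟨0, zero_mem S, 0, zero_mem S, (sub_self _).symm⟩
  | add x y _ _ hx hy =>
    obtain ⟨u, hu, v, hv, rfl⟩ := hx
    obtain ⟨u', hu', v', hv', rfl⟩ := hy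
    refine ⟨u + u', add_mem hu hu', v + v', add_mem hv hv', funext fun i ↦ ?_⟩
    simp only [Pi.add_apply, Pi.sub_apply, Nat.cast_add]
    ring
  | neg x _ hx =>
    obtain ⟨u, hu, v, hv, rfl⟩ := hx
    exact ⟨v, hv, u, hu, neg_sub _ _⟩

namespace IsGluable

variable (h : IsGluable S T c m)

include h

lemma exists_eq_add_nsmul {u v : Fin d → ℕ} {s t : ℕ} (hu : u ∈ S) (hv : v ∈ S) (hst : s ≤ t)
    (heq : m • u + s • c = m • v + t • c) : ∃ r, t = s + r * m ∧ u = v + r • c := by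
  obtain ⟨r, hr⟩ := (Nat.modEq_iff_dvd' hst).mp (h.modEq u hu v hv s t heq)
  obtain rfl : t = s + r * m := by rw [mul_comm, ← hr, Nat.add_sub_cancel' hst]
  refine ⟨r, rfl, nsmul_right_injective h.mul_ne_zero (add_right_cancel (b := s • c) ?_)⟩
  simp only [heq, nsmul_add, add_nsmul, mul_nsmul]
  abel

lemma exists_eq_add_nsmul_or {u v : Fin d → ℕ} {s t : ℕ} (hu : u + c ∈ S) (hv : v + c ∈ S)
    (heq : m • u + s • c = m • v + t • c) :
    (∃ r, t = s + r * m ∧ u = v + r • c) ∨ ∃ r, s = t + r * m ∧ v = u + r • c := by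
  have heq_add : m • (u + c) + s • c = m • (v + c) + t • c := by
    rw [nsmul_add, nsmul_add, add_right_comm, heq, add_right_comm]
  obtain hst | hts := le_total s t
  · obtain ⟨r, ht, hr⟩ := h.exists_eq_add_nsmul hu hv hst heq_add
    exact .inl ⟨r, ht, add_right_cancel (hr.trans (add_right_comm v c _))⟩
  · obtain ⟨r, hs, hr⟩ := h.exists_eq_add_nsmul hv hu hts heq_add.symm
    exact .inr ⟨r, hs, add_right_cancel (hr.trans (add_right_comm u c _))⟩

lemma nsmul_mem_minGens {g : Fin d → ℕ} (hg : g ∈ minGens S) :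
    m • g ∈ minGens (lineGluing S T c m) := by
  refine ⟨mem_lineGluing_iff.mpr ⟨g, hg.1, 0, zero_mem T, by rw [zero_nsmul, add_zero]⟩,
    smul_ne_zero h.mul_ne_zero hg.2.1, fun b hb b' hb' hsum ↦ ?_⟩
  obtain ⟨v, hv, t, ht, rfl⟩ := mem_lineGluing_iff.mp hb
  obtain ⟨v', hv', t', ht', rfl⟩ := mem_lineGluing_iff.mp hb'
  obtain ⟨r, ht_add, hg_add⟩ := h.exists_eq_add_nsmul hg.1 (add_mem hv hv') (Nat.zero_le (t + t'))
    (by rw [hsum, nsmul_add, add_nsmul, zero_nsmul, add_zero, add_add_add_comm])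
  obtain rfl : r = 0 := by
    by_contra hr
    exact notMem_minGens_add_nsmul (add_mem hv hv') h.vec_mem h.vec_ne_zero h.vec_notMem_minGens hr
      hg_add hg
  obtain ⟨rfl, rfl⟩ : t = 0 ∧ t' = 0 := by omega
  rw [zero_nsmul, add_zero] at hg_add
  simp only [zero_nsmul, add_zero]
  exact (hg.2.2 v hv v' hv' hg_add).imp (fun h0 ↦ by rw [h0, nsmul_zero])
    fun h0 ↦ by rw [h0, nsmul_zero]

lemma nsmul_vec_mem_minGens {n : ℕ} (hn : n ∈ minGens T) :
    n • c ∈ minGens (lineGluing S T c m) := by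
  refine ⟨mem_lineGluing_iff.mpr ⟨0, zero_mem S, n, hn.1, by rw [nsmul_zero, zero_add]⟩,
    smul_ne_zero hn.2.1 h.vec_ne_zero, fun b hb b' hb' hsum ↦ ?_⟩
  obtain ⟨v, hv, t, ht, rfl⟩ := mem_lineGluing_iff.mp hb
  obtain ⟨v', hv', t', ht', rfl⟩ := mem_lineGluing_iff.mp hb'
  have heq : m • (v + v') + (t + t') • c = m • 0 + n • c := by
    rw [hsum, nsmul_zero, zero_add, nsmul_add, add_nsmul, add_add_add_comm]
  obtain ⟨hn_add, hv_add⟩ : n = t + t' ∧ v + v' = 0 := by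
    obtain hle | hle := le_total (t + t') n
    · obtain ⟨r, hn_add, hv_add⟩ := h.exists_eq_add_nsmul (add_mem hv hv') (zero_mem S) hle heq
      obtain rfl : r = 0 := by
        by_contra hr
        exact notMem_minGens_add_nsmul (add_mem ht ht') h.mul_mem h.mul_ne_zero
          h.mul_notMem_minGens hr hn_add hn
      exact ⟨by rw [hn_add, zero_mul, add_zero], by rw [hv_add, zero_nsmul, add_zero]⟩
    · obtain ⟨r, ht_add, hv_add⟩ :=
        h.exists_eq_add_nsmul (zero_mem S) (add_mem hv hv') hle heq.symm
      obtain ⟨hv0, hr⟩ := add_eq_zero.mp hv_add.symm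
      rw [(smul_eq_zero.mp hr).resolve_right h.vec_ne_zero, zero_mul, add_zero] at ht_add
      exact ⟨ht_add.symm, hv0⟩
  obtain ⟨rfl, rfl⟩ := add_eq_zero.mp hv_add
  simp only [nsmul_zero, zero_add]
  exact (hn.2.2 t ht t' ht' hn_add).imp (fun h0 ↦ by rw [h0, zero_nsmul])
    fun h0 ↦ by rw [h0, zero_nsmul]

lemma minGens_lineGluing :
    minGens (lineGluing S T c m) = (m • ·) '' minGens S ∪ (· • c) '' minGens T := by
  refine subset_antisymm ?_ (Set.union_subset ?_ ?_)
  · rw [lineGluing, ← closure_nsmul_image_minGens, ← closure_image_nsmul_minGens,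
      ← AddSubmonoid.closure_union]
    exact minGens_closure_subset _
  · rintro _ ⟨g, hg, rfl⟩
    exact h.nsmul_mem_minGens hg
  · rintro _ ⟨n, hn, rfl⟩
    exact h.nsmul_vec_mem_minGens hn

lemma disjoint_minGens : Disjoint ((m • ·) '' minGens S) ((· • c) '' minGens T) := by
  rw [Set.disjoint_left]
  rintro _ ⟨g, hg, rfl⟩ ⟨n, -, heq⟩
  obtain ⟨r, -, hgr⟩ := h.exists_eq_add_nsmul hg.1 (zero_mem S) (Nat.zero_le n)
    (by simpa only [zero_nsmul, nsmul_zero, add_zero, zero_add] using heq.symm)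
  obtain rfl | hr := eq_or_ne r 0
  · exact hg.2.1 (by rw [hgr, zero_nsmul, add_zero])
  · exact notMem_minGens_add_nsmul (zero_mem S) h.vec_mem h.vec_ne_zero h.vec_notMem_minGens hr
      hgr hg

lemma embDim_lineGluing (hS : S.FG) (hT : T.FG) :
    embDim (lineGluing S T c m) = embDim S + embDim T := by
  have hinj : Function.Injective fun t : ℕ ↦ t • c :=
    (nsmul_left_strictMono (pos_iff_ne_zero.mpr h.vec_ne_zero)).injective
  rw [embDim, h.minGens_lineGluing, Set.ncard_union_eq h.disjoint_minGens
      ((finite_minGens hS).image _) ((finite_minGens hT).image _),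
    Set.ncard_image_of_injective _ (nsmul_right_injective h.mul_ne_zero),
    Set.ncard_image_of_injective _ hinj]
  rfl

lemma isGluing_lineGluing (hS : S.FG) (hT : T.FG) :
    IsGluing (lineGluing S T c m) (S.map (nsmulAddMonoidHom m)) (T.map (multiplesHom _ c))
      (m • c) := by
  have hmcS : m • c ∈ S.map (nsmulAddMonoidHom m) := ⟨c, h.vec_mem, rfl⟩
  have hmcT : m • c ∈ T.map (multiplesHom _ c) := ⟨m, h.mul_mem, rfl⟩
  refine ⟨fg_lineGluing hS hT, ⟨(m • ·) '' minGens S, (· • c) '' minGens T,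
    (nonempty_minGens h.vec_mem h.vec_ne_zero).image _,
    (nonempty_minGens h.mul_mem h.mul_ne_zero).image _, h.disjoint_minGens,
    h.minGens_lineGluing.symm, closure_nsmul_image_minGens S m, closure_image_nsmul_minGens T c⟩,
    hmcS, hmcT, le_antisymm ?_ ?_⟩
  · rintro x ⟨hxS, hxT⟩
    obtain ⟨_, ⟨u, hu, rfl⟩, _, ⟨v, hv, rfl⟩, rfl⟩ := exists_sub_of_mem_groupOf hxS
    obtain ⟨_, ⟨t, -, rfl⟩, _, ⟨s, -, rfl⟩, heq⟩ := exists_sub_of_mem_groupOf hxT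
    have hcoord (i : Fin d) : (m * u i : ℤ) - m * v i = t * c i - s * c i := by
      simpa using congrFun heq i
    have heq_nat : m • u + s • c = m • v + t • c := by
      ext i
      zify [Pi.add_apply, Pi.smul_apply]
      simp only [smul_eq_mul, Nat.cast_mul]
      linear_combination hcoord i
    obtain ⟨r, hr⟩ := Nat.modEq_iff_dvd.mp (h.modEq u hu v hv s t heq_nat)
    refine AddSubgroup.mem_zmultiples_iff.mpr ⟨r, ?_⟩
    rw [heq]
    ext i
    simp only [Pi.smul_apply, Pi.sub_apply, multiplesHom_apply, smul_eq_mul, Nat.cast_mul]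
    linear_combination -(c i : ℤ) * hr
  · rw [AddSubgroup.zmultiples_le]
    exact ⟨AddSubgroup.subset_closure ⟨_, hmcS, rfl⟩, AddSubgroup.subset_closure ⟨_, hmcT, rfl⟩⟩

lemma add_nsmul_mem_PF_lineGluing {f : Fin d → ℕ} {H : ℕ} (hf : f ∈ PF S)
    (hH : H ∈ maximalApery T m) : m • f + H • c ∈ PF (lineGluing S T c m) := by
  obtain ⟨⟨hf_cone, hfS⟩, hf_add⟩ := hf
  obtain ⟨hHT, hHm, hH_add⟩ := hH
  refine ⟨⟨add_nsmul_mem_cone_lineGluing h.mul_ne_zero hf_cone hHT, fun hmem ↦ ?_⟩,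
    fun x hx hx0 ↦ ?_⟩
  · obtain ⟨v, hv, t, ht, heq⟩ := mem_lineGluing_iff.mp hmem
    obtain ⟨r, -, hfv⟩ | ⟨r, rfl, hvf⟩ := h.exists_eq_add_nsmul_or
      (hf_add c h.vec_mem h.vec_ne_zero) (add_mem hv h.vec_mem) heq.symm
    · exact hfS (hfv ▸ add_mem hv (nsmul_mem h.vec_mem r))
    · rw [eq_zero_of_add_mul_notMem h.mul_mem ht hHm, zero_nsmul, add_zero] at hvf
      exact hfS (hvf ▸ hv)
  · obtain ⟨v, hv, t, ht, rfl⟩ := mem_lineGluing_iff.mp hx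
    rw [mem_lineGluing_iff]
    obtain rfl | hv0 := eq_or_ne v 0
    · have ht0 : t ≠ 0 := by
        rintro rfl
        exact hx0 (by rw [nsmul_zero, zero_nsmul, add_zero])
      obtain ⟨t', ht', heq⟩ := hH_add t ht ht0
      refine ⟨f + c, hf_add c h.vec_mem h.vec_ne_zero, t', ht', ?_⟩
      rw [nsmul_zero, zero_add, add_assoc, ← add_nsmul, ← heq, add_nsmul, nsmul_add, add_assoc]
    · refine ⟨f + v, hf_add v hv hv0, H + t, add_mem hHT ht, ?_⟩
      rw [nsmul_add, add_nsmul, add_add_add_comm]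

lemma injOn_maximalApery_prod_PF :
    Set.InjOn (fun x : ℕ × (Fin d → ℕ) ↦ m • x.2 + x.1 • c) (maximalApery T m ×ˢ PF S) := by
  rintro ⟨H, f⟩ ⟨hH : H ∈ _, hf : f ∈ _⟩ ⟨H', f'⟩ ⟨hH' : H' ∈ _, hf' : f' ∈ _⟩ heq
  obtain ⟨r, rfl, rfl⟩ | ⟨r, rfl, rfl⟩ := h.exists_eq_add_nsmul_or
    (hf.2 c h.vec_mem h.vec_ne_zero) (hf'.2 c h.vec_mem h.vec_ne_zero) heq
  · rw [eq_zero_of_add_mul_notMem h.mul_mem hH.1 hH'.2.1, zero_mul, zero_nsmul, add_zero, add_zero]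
  · rw [eq_zero_of_add_mul_notMem h.mul_mem hH'.1 hH.2.1, zero_mul, zero_nsmul, add_zero, add_zero]

theorem ncard_mul_bettiType_le (hS : S.FG) (hT : T.FG) {A : Set ℕ} (hA : A ⊆ maximalApery T m) :
    A.ncard * bettiType S ≤ bettiType (lineGluing S T c m) := by
  have hinj := h.injOn_maximalApery_prod_PF.mono (Set.prod_mono_left hA)
  rw [bettiType, ← Set.ncard_prod, ← hinj.ncard_image]
  refine Set.ncard_le_ncard ?_ (finite_PF (fg_lineGluing hS hT))
  rintro _ ⟨⟨H, f⟩, ⟨hH, hf⟩, rfl⟩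
  exact h.add_nsmul_mem_PF_lineGluing hf (hA hH)

theorem isMPD_lineGluing (k : Type*) [Field k] (hS : S.FG) (hT : T.FG) (hPF : (PF S).Nonempty)
    (hApery : (maximalApery T m).Nonempty) : IsMPD k (lineGluing S T c m) := by
  obtain ⟨f, hf⟩ := hPF
  obtain ⟨H, hH⟩ := hApery
  exact isMPD_of_PF_nonempty k (fg_lineGluing hS hT) ⟨_, h.add_nsmul_mem_PF_lineGluing hf hH⟩

end IsGluable

end Gluing

section Sap

variable {a p : ℕ}

/-- The vectors `N (2, 2) + α (a, 0) + β (0, a ^ p)`. Since `(a + 2, 2) = (2, 2) + (a, 0)` and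
`(2, 2 + a ^ p) = (2, 2) + (0, a ^ p)`, those in `S_{a,p}` are the ones with `N ≤ α + β` for some
choice of coefficients. -/
def sapVec (a p N α β : ℕ) : Fin 2 → ℕ :=
  ![2 * N + a * α, 2 * N + a ^ p * β]

lemma sapVec_eq_iff {N α β x y : ℕ} :
    sapVec a p N α β = ![x, y] ↔ 2 * N + a * α = x ∧ 2 * N + a ^ p * β = y := by
  simp [sapVec]

lemma sapVec_add (N α β N' α' β' : ℕ) :
    sapVec a p N α β + sapVec a p N' α' β' = sapVec a p (N + N') (α + α') (β + β') := by
  ext i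
  fin_cases i <;> simp [sapVec] <;> ring

lemma mem_sap_iff {x : Fin 2 → ℕ} :
    x ∈ sap a p ↔ ∃ N α β : ℕ, N ≤ α + β ∧ sapVec a p N α β = x := by
  constructor
  · intro hx
    induction hx using AddSubmonoid.closure_induction with
    | mem x hx =>
      obtain rfl | rfl | rfl | rfl := hx
      · exact ⟨0, 1, 0, by simp [sapVec]⟩
      · exact ⟨0, 0, 1, by simp [sapVec]⟩
      · exact ⟨1, 1, 0, by simp [sapVec, add_comm]⟩
      · exact ⟨1, 0, 1, by simp [sapVec]⟩
    | zero => exact ⟨0, 0, 0, le_rfl, by simp [sapVec]⟩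
    | add x y _ _ hx hy =>
      obtain ⟨N, α, β, hN, rfl⟩ := hx
      obtain ⟨N', α', β', hN', rfl⟩ := hy
      exact ⟨N + N', α + α', β + β', by omega, (sapVec_add ..).symm⟩
  · rintro ⟨N, α, β, hN, rfl⟩
    obtain ⟨i, j, k, l, rfl, rfl, rfl⟩ : ∃ i j k l, α = i + k ∧ β = j + l ∧ N = k + l :=
      ⟨α - min N α, β - (N - min N α), min N α, N - min N α, by omega, by omega, by omega⟩
    have hx : sapVec a p (k + l) (i + k) (j + l) =
        i • ![a, 0] + j • ![0, a ^ p] + k • ![a + 2, 2] + l • ![2, 2 + a ^ p] := by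
      ext x
      fin_cases x <;> simp [sapVec] <;> ring
    rw [hx]
    refine add_mem (add_mem (add_mem ?_ ?_) ?_) ?_ <;>
      exact nsmul_mem (AddSubmonoid.subset_closure (by simp [sapGens])) _

lemma sapVec_mem_sap {N α β : ℕ} (hN : N ≤ α + β) : sapVec a p N α β ∈ sap a p :=
  mem_sap_iff.mpr ⟨N, α, β, hN, rfl⟩

lemma fg_sap (a p : ℕ) : (sap a p).FG :=
  (AddSubmonoid.fg_iff _).mpr ⟨_, rfl, by simp [sapGens]⟩

lemma three_le_pow (ha : 3 ≤ a) (hp : 1 ≤ p) : 3 ≤ a ^ p :=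
  ha.trans (Nat.le_self_pow (Nat.one_le_iff_ne_zero.mp hp) a)

lemma add_eq_one_of_sapVec_mem_sapGens (ha : 3 ≤ a) (hp : 1 ≤ p) {N α β : ℕ}
    (h : sapVec a p N α β ∈ sapGens a p) : α + β = 1 := by
  have hq := three_le_pow ha hp
  simp only [sapGens, Set.mem_insert_iff, Set.mem_singleton_iff, sapVec_eq_iff] at h
  generalize a ^ p = q at h hq
  have hα : α < 2 := by
    by_contra! hα
    have := Nat.mul_le_mul_left a hα
    omega
  have hβ : β < 2 := by
    by_contra! hβ
    have := Nat.mul_le_mul_left q hβ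
    omega
  interval_cases α <;> interval_cases β <;> omega

theorem minGens_sap (ha : 3 ≤ a) (hp : 1 ≤ p) : minGens (sap a p) = sapGens a p := by
  refine (minGens_closure_subset _).antisymm fun g hg ↦
    ⟨AddSubmonoid.subset_closure hg, ?_, fun b hb c hc h ↦ ?_⟩
  · rintro rfl
    have h0 : sapVec a p 0 0 0 = 0 := by simp [sapVec]
    exact zero_ne_one (add_eq_one_of_sapVec_mem_sapGens ha hp (h0 ▸ hg))
  · obtain ⟨N, α, β, hN, rfl⟩ := mem_sap_iff.mp hb
    obtain ⟨N', α', β', hN', rfl⟩ := mem_sap_iff.mp hc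
    rw [h, sapVec_add] at hg
    have hsum := add_eq_one_of_sapVec_mem_sapGens ha hp hg
    obtain h0 | h0 : α + β = 0 ∨ α' + β' = 0 := by omega
    · obtain ⟨rfl, rfl, rfl⟩ : N = 0 ∧ α = 0 ∧ β = 0 := by omega
      exact .inl (by simp [sapVec])
    · obtain ⟨rfl, rfl, rfl⟩ : N' = 0 ∧ α' = 0 ∧ β' = 0 := by omega
      exact .inr (by simp [sapVec])

lemma ncard_sapGens (ha : 3 ≤ a) : (sapGens a p).ncard = 4 := by
  have h₁ : (![a, 0] : Fin 2 → ℕ) ∉ ({![0, a ^ p], ![a + 2, 2], ![2, 2 + a ^ p]} : Set _) := by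
    simp only [Set.mem_insert_iff, Set.mem_singleton_iff, Matrix.vecCons_inj, and_true]
    omega
  have h₂ : (![0, a ^ p] : Fin 2 → ℕ) ∉ ({![a + 2, 2], ![2, 2 + a ^ p]} : Set _) := by
    simp
  have h₃ : (![a + 2, 2] : Fin 2 → ℕ) ∉ ({![2, 2 + a ^ p]} : Set _) := by
    simp only [Set.mem_singleton_iff, Matrix.vecCons_inj, and_true]
    omega
  rw [sapGens, Set.ncard_insert_of_notMem h₁, Set.ncard_insert_of_notMem h₂,
    Set.ncard_insert_of_notMem h₃, Set.ncard_singleton]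

theorem embDim_sap (ha : 3 ≤ a) (hp : 1 ≤ p) : embDim (sap a p) = 4 := by
  rw [embDim, minGens_sap ha hp, ncard_sapGens ha]

lemma sapVec_add_pow (a r N α β : ℕ) : sapVec a (r + 1) (N + a ^ (r + 1)) α β =
    sapVec a (r + 1) N (α + 2 * a ^ r) (β + 2) := by
  refine sapVec_eq_iff.mpr ⟨?_, ?_⟩ <;> ring

lemma sapVec_notMem_sap (hodd : Odd a) {α β : ℕ} (hq : α + β + 2 = a ^ p) :
    sapVec a p (α + β + 1) α β ∉ sap a p := by
  intro hmem
  obtain ⟨N, α', β', hN, heq⟩ := mem_sap_iff.mp hmem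
  obtain ⟨h₀, h₁⟩ := sapVec_eq_iff.mp heq
  have hdvd : a ^ p ∣ N + 1 := by
    have hcop : Nat.Coprime (a ^ p) 2 := hodd.pow.coprime_two_right
    refine hcop.dvd_of_dvd_mul_left ((Nat.dvd_add_left (dvd_mul_right _ β')).mp ⟨β + 2, ?_⟩)
    rw [mul_add _ β 2]
    omega
  have hle : a ^ p ≤ N + 1 := Nat.le_of_dvd N.succ_pos hdvd
  have hα : α' ≤ α := Nat.le_of_mul_le_mul_left (by omega : a * α' ≤ a * α) hodd.pos
  have hβ : β' ≤ β :=
    Nat.le_of_mul_le_mul_left (by omega : a ^ p * β' ≤ a ^ p * β) hodd.pow.pos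
  omega

lemma sapVec_add_mem_sap (hp : 1 ≤ p) {α β : ℕ} (hq : α + β + 2 = a ^ p) {s : Fin 2 → ℕ}
    (hs : s ∈ sap a p) (hs0 : s ≠ 0) : sapVec a p (α + β + 1) α β + s ∈ sap a p := by
  obtain ⟨N, α', β', hN, rfl⟩ := mem_sap_iff.mp hs
  rw [sapVec_add]
  obtain rfl | hN0 := eq_or_ne N 0
  · have hpos : α' + β' ≠ 0 := by
      intro h0
      obtain ⟨rfl, rfl⟩ := add_eq_zero.mp h0
      exact hs0 (by simp [sapVec])
    exact sapVec_mem_sap (by omega)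
  · obtain ⟨N, rfl⟩ := Nat.exists_eq_add_one_of_ne_zero hN0
    obtain ⟨r, rfl⟩ := Nat.exists_eq_add_of_le' hp
    have hN_add : α + β + 1 + (N + 1) = N + a ^ (r + 1) := by omega
    rw [hN_add, sapVec_add_pow]
    exact sapVec_mem_sap (by omega)

theorem sapVec_mem_PF (hodd : Odd a) (hp : 1 ≤ p) {α β : ℕ} (hq : α + β + 2 = a ^ p) :
    sapVec a p (α + β + 1) α β ∈ PF (sap a p) :=
  ⟨⟨mem_cone_of_axes (c := a) (e := a ^ p) hodd.pos.ne' hodd.pow.pos.ne'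
      (AddSubmonoid.subset_closure (by simp [sapGens]))
      (AddSubmonoid.subset_closure (by simp [sapGens])) _,
    sapVec_notMem_sap hodd hq⟩, fun _ ↦ sapVec_add_mem_sap hp hq⟩

theorem le_bettiType_sap (hodd : Odd a) (hp : 1 ≤ p) : a ^ p - 1 ≤ bettiType (sap a p) := by
  obtain hq | ⟨n, hn⟩ : a ^ p - 1 = 0 ∨ ∃ n, n + 2 = a ^ p :=
    or_iff_not_imp_left.mpr fun h ↦ ⟨a ^ p - 2, by omega⟩
  · exact hq ▸ Nat.zero_le _
  let antidiag : Finset (ℕ × ℕ) := Finset.HasAntidiagonal.antidiagonal n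
  let φ : ℕ × ℕ → Fin 2 → ℕ := fun x ↦ sapVec a p (x.1 + x.2 + 1) x.1 x.2
  have hinj : Set.InjOn φ antidiag := by
    rintro ⟨α, β⟩ hx ⟨α', β'⟩ hx' heq
    obtain rfl := Finset.HasAntidiagonal.mem_antidiagonal.mp hx
    have hsum : α' + β' = α + β := Finset.HasAntidiagonal.mem_antidiagonal.mp hx'
    have hα : α = α' := by
      have h₀ := (sapVec_eq_iff.mp heq).1
      simp only [hsum] at h₀
      exact Nat.eq_of_mul_eq_mul_left hodd.pos (add_left_cancel h₀)
    exact Prod.ext hα (by dsimp only; omega)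
  have hsub : φ '' antidiag ⊆ PF (sap a p) := by
    rintro _ ⟨⟨α, β⟩, hx, rfl⟩
    exact sapVec_mem_PF hodd hp (by rw [← hn, ← Finset.HasAntidiagonal.mem_antidiagonal.mp hx])
  calc a ^ p - 1 = (φ '' antidiag).ncard := by
        rw [hinj.ncard_image, Set.ncard_coe_finset, Finset.Nat.card_antidiagonal, ← hn]
        rfl
    _ ≤ bettiType (sap a p) := Set.ncard_le_ncard hsub (finite_PF (fg_sap a p))

lemma nonempty_PF_sap (ha : 3 ≤ a) (hodd : Odd a) (hp : 1 ≤ p) : (PF (sap a p)).Nonempty := by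
  have hq := three_le_pow ha hp
  have hle := le_bettiType_sap hodd hp
  exact Set.nonempty_of_ncard_ne_zero (by rw [bettiType] at hle; omega)

lemma dvd_of_mul_eq {m : ℕ} (hm : m ≠ 0) (hodd : Odd a) (h : 2 ≤ p ∨ Nat.Coprime a m)
    {N α β t : ℤ} (h₀ : m * (2 * N + a * α) = t * a)
    (h₁ : m * (2 * N + (a : ℤ) ^ p * β) = t * (a : ℤ) ^ p) : (m : ℤ) ∣ t := by
  have hm0 : (m : ℤ) ≠ 0 := Nat.cast_ne_zero.mpr hm
  have hcop2 : IsCoprime (a : ℤ) 2 :=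
    mod_cast Nat.isCoprime_iff_coprime.mpr hodd.coprime_two_right
  obtain ⟨N, rfl⟩ : (a : ℤ) ∣ N := by
    refine hcop2.dvd_of_dvd_mul_left ?_
    obtain hp2 | hcop := h
    · obtain ⟨r, rfl⟩ := Nat.exists_eq_add_of_le' hp2
      have hcop : IsCoprime (a : ℤ) ((a : ℤ) ^ (r + 1) - 1) := ⟨a ^ r, -1, by ring⟩
      refine hcop.dvd_of_dvd_mul_right ⟨a ^ (r + 1) * (β - α), mul_left_cancel₀ hm0 ?_⟩
      linear_combination (a : ℤ) ^ (r + 1) * h₀ - h₁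
    · refine (Nat.isCoprime_iff_coprime.mpr hcop).dvd_of_dvd_mul_left ⟨t - m * α, ?_⟩
      linear_combination h₀
  refine ⟨2 * N + α, mul_right_cancel₀ (Nat.cast_ne_zero.mpr hodd.pos.ne' : (a : ℤ) ≠ 0) ?_⟩
  linear_combination -h₀

lemma modEq_of_nsmul_add_nsmul_eq {m : ℕ} (hm : m ≠ 0) (hodd : Odd a)
    (h : 2 ≤ p ∨ Nat.Coprime a m) {N α β N' α' β' s t : ℕ}
    (heq : m • sapVec a p N α β + s • ![a, a ^ p] = m • sapVec a p N' α' β' + t • ![a, a ^ p]) :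
    s ≡ t [MOD m] := by
  have h₀ := congrFun heq 0
  have h₁ := congrFun heq 1
  simp only [sapVec, Pi.add_apply, Pi.smul_apply, smul_eq_mul, Matrix.cons_val_zero,
    Matrix.cons_val_one] at h₀ h₁
  zify at h₀ h₁
  refine Nat.modEq_iff_dvd.mpr
    (dvd_of_mul_eq hm hodd h (N := N - N') (α := α - α') (β := β - β') ?_ ?_)
  · linear_combination h₀
  · linear_combination h₁

theorem isGluable_sap {T : AddSubmonoid ℕ} {m : ℕ} (hodd : Odd a)
    (h : 2 ≤ p ∨ Nat.Coprime a m) (hm : m ≠ 0) (hmT : m ∈ T) (hmgen : m ∉ minGens T) :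
    IsGluable (sap a p) T ![a, a ^ p] m where
  vec_mem := mem_sap_iff.mpr ⟨0, 1, 1, Nat.zero_le _, by simp [sapVec]⟩
  vec_ne_zero := by simp [hodd.pos.ne']
  vec_notMem_minGens := by
    intro hgen
    have hsum : (![a, a ^ p] : Fin 2 → ℕ) = ![a, 0] + ![0, a ^ p] := by simp
    obtain h0 | h0 := hgen.2.2 _ (AddSubmonoid.subset_closure (by simp [sapGens])) _
      (AddSubmonoid.subset_closure (by simp [sapGens])) hsum
    · exact hodd.pos.ne' (congrFun h0 0)
    · exact hodd.pow.pos.ne' (congrFun h0 1)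
  mul_mem := hmT
  mul_ne_zero := hm
  mul_notMem_minGens := hmgen
  modEq := by
    intro u hu v hv s t heq
    obtain ⟨N, α, β, -, rfl⟩ := mem_sap_iff.mp hu
    obtain ⟨N', α', β', -, rfl⟩ := mem_sap_iff.mp hv
    exact modEq_of_nsmul_add_nsmul_eq hm hodd h heq

end Sap

section Glued

variable {a p m s : ℕ} {n : Fin s → ℕ}

lemma closure_scaledSapGens (a p m : ℕ) :
    AddSubmonoid.closure (scaledSapGens a p m) = (sap a p).map (nsmulAddMonoidHom m) :=
  (AddMonoidHom.map_mclosure (nsmulAddMonoidHom m) (sapGens a p)).symm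

lemma closure_scaledNumGens (a p : ℕ) (n : Fin s → ℕ) :
    AddSubmonoid.closure (scaledNumGens a p n) =
      (AddSubmonoid.closure (Set.range n)).map (multiplesHom _ ![a, a ^ p]) := by
  rw [AddMonoidHom.map_mclosure, ← Set.range_comp]
  rfl

lemma glued_eq_lineGluing (a p m : ℕ) (n : Fin s → ℕ) :
    glued a p m n = lineGluing (sap a p) (AddSubmonoid.closure (Set.range n)) ![a, a ^ p] m := by
  rw [glued, AddSubmonoid.closure_union, closure_scaledSapGens, closure_scaledNumGens, lineGluing]

lemma fg_closure_range (n : Fin s → ℕ) : (AddSubmonoid.closure (Set.range n)).FG :=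
  (AddSubmonoid.fg_iff _).mpr ⟨_, rfl, Set.finite_range n⟩

theorem glued_properties (ha : 3 ≤ a) (hodd : Odd a) (hp : 1 ≤ p) (hinj : Function.Injective n)
    (hn : minGens (AddSubmonoid.closure (Set.range n)) = Set.range n)
    (h : IsGluable (sap a p) (AddSubmonoid.closure (Set.range n)) ![a, a ^ p] m) {A : Set ℕ}
    (hA : A ⊆ maximalApery (AddSubmonoid.closure (Set.range n)) m) (hA0 : A.Nonempty) :
    IsSapGluing a p m n ∧ embDim (glued a p m n) = s + 4 ∧
      (∀ (k : Type u) [Field k], IsMPD k (glued a p m n)) ∧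
      (PF (glued a p m n)).Finite ∧ A.ncard * (a ^ p - 1) ≤ bettiType (glued a p m n) := by
  have hS := fg_sap a p
  have hT := fg_closure_range n
  have hembDim : embDim (AddSubmonoid.closure (Set.range n)) = s := by
    rw [embDim, hn, ← Set.image_univ, Set.ncard_image_of_injective _ hinj, Set.ncard_univ,
      Nat.card_fin]
  rw [IsSapGluing, closure_scaledSapGens, closure_scaledNumGens, glued_eq_lineGluing]
  exact ⟨h.isGluing_lineGluing hS hT,
    by rw [h.embDim_lineGluing hS hT, embDim_sap ha hp, hembDim, add_comm],
    fun k _ ↦ h.isMPD_lineGluing k hS hT (nonempty_PF_sap ha hodd hp) (hA0.mono hA),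
    finite_PF (fg_lineGluing hS hT),
    (Nat.mul_le_mul_left _ (le_bettiType_sap hodd hp)).trans (h.ncard_mul_bettiType_le hS hT hA)⟩

end Glued

section Numerical

variable {s : ℕ} {n : Fin s → ℕ}

lemma minGens_top_nat : minGens (⊤ : AddSubmonoid ℕ) = {1} := by
  refine subset_antisymm ?_ (Set.singleton_subset_iff.mpr
    ⟨AddSubmonoid.mem_top 1, one_ne_zero, fun b _ c _ h ↦ by omega⟩)
  rw [← Nat.addSubmonoidClosure_one]
  exact minGens_closure_subset _

lemma pos_of_isNumericalGenerators (hn : IsNumericalGenerators n) (i : Fin s) : 0 < n i := by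
  have hi : n i ∈ minGens (AddSubmonoid.closure (Set.range n)) := hn.2.1.ge (Set.mem_range_self i)
  exact Nat.pos_of_ne_zero hi.2.1

lemma sum_notMem_minGens (hs : 2 ≤ s) (hn : IsNumericalGenerators n) :
    ∑ i, n i ∉ minGens (AddSubmonoid.closure (Set.range n)) := by
  rw [hn.2.1]
  rintro ⟨i, hi⟩
  have : Nontrivial (Fin s) := Fin.nontrivial_iff_two_le.mpr hs
  obtain ⟨j, hj⟩ := exists_ne i
  exact (Finset.single_lt_sum hj (Finset.mem_univ i) (Finset.mem_univ j)
    (pos_of_isNumericalGenerators hn j) fun _ _ _ ↦ Nat.zero_le _).ne hi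

lemma one_notMem_closure_range (hs : 2 ≤ s) (hn : IsNumericalGenerators n) :
    1 ∉ AddSubmonoid.closure (Set.range n) := by
  intro h1
  have htop : AddSubmonoid.closure (Set.range n) = ⊤ :=
    top_le_iff.mp (Nat.addSubmonoidClosure_one ▸ AddSubmonoid.closure_le.mpr
      (Set.singleton_subset_iff.mpr h1))
  have hrange : Set.range n = {1} := by rw [← hn.2.1, htop, minGens_top_nat]
  have hone (i : Fin s) : n i = 1 := hrange.subset (Set.mem_range_self i)
  have : Nontrivial (Fin s) := Fin.nontrivial_iff_two_le.mpr hs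
  obtain ⟨i, j, hij⟩ := exists_pair_ne (Fin s)
  exact hij (hn.1 ((hone i).trans (hone j).symm))

lemma nonempty_numericalPF {T : AddSubmonoid ℕ} (hfin : {x | x ∉ T}.Finite) (h1 : 1 ∉ T) :
    (numericalPF T).Nonempty := by
  obtain ⟨f, hf, hmax⟩ := Set.exists_max_image _ id hfin ⟨1, h1⟩
  refine ⟨f, hf, fun t _ ht0 ↦ ?_⟩
  by_contra hft
  have hle : f + t ≤ f := hmax (f + t) hft
  omega

lemma mem_closure_range_interval {x : ℕ} (hs : s ≠ 0) :
    x ∈ AddSubmonoid.closure (Set.range fun i : Fin s ↦ s + (i : ℕ)) ↔ x = 0 ∨ s ≤ x := by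
  constructor
  · intro hx
    induction hx using AddSubmonoid.closure_induction with
    | mem x hx =>
      obtain ⟨i, rfl⟩ := hx
      exact .inr (Nat.le_add_right _ _)
    | zero => exact .inl rfl
    | add x y _ _ hx hy => omega
  · rintro (rfl | hx)
    · exact zero_mem _
    induction x using Nat.strong_induction_on with
    | _ x ih =>
      by_cases hx2 : x < 2 * s
      · exact AddSubmonoid.subset_closure ⟨⟨x - s, by omega⟩, Nat.add_sub_cancel' hx⟩
      · have hadd := add_mem (ih (x - s) (by omega) (by omega)) (ih s (by omega) le_rfl)
        rwa [Nat.sub_add_cancel hx] at hadd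

lemma isNumericalGenerators_interval (hs : s ≠ 0) :
    IsNumericalGenerators fun i : Fin s ↦ s + (i : ℕ) := by
  refine ⟨fun i j h ↦ Fin.ext (add_left_cancel h), (minGens_closure_subset _).antisymm ?_,
    (Set.finite_Iio s).subset fun x hx ↦ ?_⟩
  · rintro _ ⟨i, rfl⟩
    refine ⟨AddSubmonoid.subset_closure ⟨i, rfl⟩, by dsimp only; omega, fun b hb c hc h ↦ ?_⟩
    rw [mem_closure_range_interval hs] at hb hc
    dsimp only at h
    omega
  · rw [Set.mem_ofPred_eq, mem_closure_range_interval hs] at hx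
    exact Set.mem_Iio.mpr (by omega)

end Numerical

section Classes

variable {a p : ℕ}

theorem sap_properties (ha : 3 ≤ a) (hodd : Odd a) (hp : 1 ≤ p) :
    embDim (sap a p) = 4 ∧ (∀ (k : Type u) [Field k], IsMPD k (sap a p)) ∧
      (PF (sap a p)).Finite ∧ a ^ p - 1 ≤ bettiType (sap a p) :=
  ⟨embDim_sap ha hp, fun k _ ↦ isMPD_of_PF_nonempty k (fg_sap a p) (nonempty_PF_sap ha hodd hp),
    finite_PF (fg_sap a p), le_bettiType_sap hodd hp⟩

theorem glued_one_properties {m : ℕ} (ha : 3 ≤ a) (hodd : Odd a) (hp : 1 ≤ p) (hm : 2 ≤ m)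
    (h : 2 ≤ p ∨ Nat.Coprime a m) :
    IsSapGluing a p m ![1] ∧ embDim (glued a p m ![1]) = 5 ∧
      (∀ (k : Type u) [Field k], IsMPD k (glued a p m ![1])) ∧
      (PF (glued a p m ![1])).Finite ∧ a ^ p - 1 ≤ bettiType (glued a p m ![1]) := by
  have hrange : Set.range (![1] : Fin 1 → ℕ) = {1} := Set.range_unique
  have htop : AddSubmonoid.closure (Set.range (![1] : Fin 1 → ℕ)) = ⊤ := by
    rw [hrange, Nat.addSubmonoidClosure_one]
  have hm0 : m ≠ 0 := by omega
  have hmgen : m ∉ minGens (⊤ : AddSubmonoid ℕ) := by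
    rw [minGens_top_nat, Set.mem_singleton_iff]
    omega
  have hglued := glued_properties (A := {m - 1}) ha hodd hp
    (Function.injective_of_subsingleton _) (by rw [htop, minGens_top_nat, hrange])
    (htop ▸ isGluable_sap hodd h hm0 (AddSubmonoid.mem_top m) hmgen)
    (htop ▸ Set.singleton_subset_iff.mpr (sub_one_mem_maximalApery_top hm0))
    (Set.singleton_nonempty _)
  rwa [Set.ncard_singleton, one_mul] at hglued

theorem glued_sum_properties {s : ℕ} {n : Fin s → ℕ} (ha : 3 ≤ a) (hodd : Odd a) (hp : 1 ≤ p)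
    (hs : 2 ≤ s) (hn : IsNumericalGenerators n) (h : 2 ≤ p ∨ Nat.Coprime a (∑ i, n i)) :
    IsSapGluing a p (∑ i, n i) n ∧ embDim (glued a p (∑ i, n i) n) = s + 4 ∧
      (∀ (k : Type u) [Field k], IsMPD k (glued a p (∑ i, n i) n)) ∧
      (PF (glued a p (∑ i, n i) n)).Finite ∧
      (numericalPF (AddSubmonoid.closure (Set.range n))).ncard * (a ^ p - 1) ≤
        bettiType (glued a p (∑ i, n i) n) := by
  have hmem : ∑ i, n i ∈ AddSubmonoid.closure (Set.range n) :=
    sum_mem fun i _ ↦ AddSubmonoid.subset_closure (Set.mem_range_self i)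
  have hpos : ∑ i, n i ≠ 0 := fun h0 ↦ (pos_of_isNumericalGenerators hn ⟨0, by omega⟩).ne'
    (Finset.sum_eq_zero_iff.mp h0 _ (Finset.mem_univ _))
  rw [← Set.ncard_image_of_injective _ (add_right_injective (∑ i, n i))]
  exact glued_properties ha hodd hp hn.1 hn.2.1
    (isGluable_sap hodd h hpos hmem (sum_notMem_minGens hs hn))
    (image_numericalPF_subset_maximalApery hmem hpos)
    ((nonempty_numericalPF hn.2.2 (one_notMem_closure_range hs hn)).image _)

theorem exists_isMPD_le_bettiType {e : ℕ} (he : 4 ≤ e) (N : ℕ) :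
    ∃ S : AddSubmonoid (Fin 2 → ℕ), embDim S = e ∧ (∀ (k : Type u) [Field k], IsMPD k S) ∧
      (PF S).Finite ∧ N ≤ bettiType S := by
  obtain ⟨a, ha, hodd, hN⟩ : ∃ a, 3 ≤ a ∧ Odd a ∧ N ≤ a ^ 2 - 1 := by
    refine ⟨2 * N + 3, by omega, ⟨N + 1, by ring⟩, ?_⟩
    have := Nat.le_self_pow two_ne_zero (2 * N + 3)
    omega
  obtain rfl | rfl | ⟨s, hs, rfl⟩ : e = 4 ∨ e = 5 ∨ ∃ s, 2 ≤ s ∧ e = s + 4 := by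
    obtain h | h | h : e = 4 ∨ e = 5 ∨ 6 ≤ e := by omega
    exacts [.inl h, .inr (.inl h), .inr (.inr ⟨e - 4, by omega, by omega⟩)]
  · obtain ⟨hdim, hMPD, hfin, hle⟩ := sap_properties ha hodd one_le_two
    exact ⟨_, hdim, hMPD, hfin, hN.trans hle⟩
  · obtain ⟨-, hdim, hMPD, hfin, hle⟩ :=
      glued_one_properties ha hodd one_le_two le_rfl (.inl le_rfl)
    exact ⟨_, hdim, hMPD, hfin, hN.trans hle⟩
  · have hn := isNumericalGenerators_interval (by omega : s ≠ 0)
    obtain ⟨-, hdim, hMPD, hfin, hle⟩ :=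
      glued_sum_properties ha hodd one_le_two hs hn (.inl le_rfl)
    have hpos := (Set.ncard_pos (hn.2.2.subset fun f hf ↦ hf.1)).mpr
      (nonempty_numericalPF hn.2.2 (one_notMem_closure_range hs hn))
    exact ⟨_, hdim, hMPD, hfin, hN.trans ((Nat.le_mul_of_pos_left _ hpos).trans hle)⟩

end Classes

end AffineSemigroup

end

open AffineSemigroup in
theorem mainTheorem5 :
    -- for every `e ≥ 4`, the Betti-type of MPD-semigroups in `ℕ²` of embedding dimension `e`
    -- is unbounded
    (∀ e : ℕ, 4 ≤ e → ∀ N : ℕ, ∃ S : AddSubmonoid (Fin 2 → ℕ),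
      embDim S = e ∧ (∀ (k : Type u) [Field k], IsMPD k S) ∧
      (PF S).Finite ∧ N ≤ bettiType S) ∧
    -- the class for `e = 4`
    (∀ a p : ℕ, 3 ≤ a → Odd a → 1 ≤ p →
      embDim (sap a p) = 4 ∧ (∀ (k : Type u) [Field k], IsMPD k (sap a p)) ∧
      (PF (sap a p)).Finite ∧ a ^ p - 1 ≤ bettiType (sap a p)) ∧
    -- the class for `e = 5`: gluing with a multiple of the numerical semigroup `ℕ = ⟨1⟩`
    (∀ a p m : ℕ, 3 ≤ a → Odd a → 1 ≤ p → 2 ≤ m → (2 ≤ p ∨ Nat.Coprime a m) →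
      IsSapGluing a p m ![1] ∧ embDim (glued a p m ![1]) = 5 ∧
      (∀ (k : Type u) [Field k], IsMPD k (glued a p m ![1])) ∧
      (PF (glued a p m ![1])).Finite ∧ a ^ p - 1 ≤ bettiType (glued a p m ![1])) ∧
    -- the class for `e = s + 4 ≥ 6`: gluing with a numerical semigroup with `s` generators
    (∀ a p : ℕ, 3 ≤ a → Odd a → 1 ≤ p →
      ∀ (s : ℕ) (n : Fin s → ℕ), 2 ≤ s → IsNumericalGenerators n →
      (2 ≤ p ∨ Nat.Coprime a (∑ i, n i)) →
      IsSapGluing a p (∑ i, n i) n ∧ embDim (glued a p (∑ i, n i) n) = s + 4 ∧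
      (∀ (k : Type u) [Field k], IsMPD k (glued a p (∑ i, n i) n)) ∧
      (PF (glued a p (∑ i, n i) n)).Finite ∧
      (numericalPF (AddSubmonoid.closure (Set.range n))).ncard * (a ^ p - 1) ≤
        bettiType (glued a p (∑ i, n i) n)) :=
  ⟨fun _ he N ↦ exists_isMPD_le_bettiType he N,
    fun _ _ ha hodd hp ↦ sap_properties ha hodd hp,
    fun _ _ _ ha hodd hp hm h ↦ glued_one_properties ha hodd hp hm h,
    fun _ _ ha hodd hp _ _ hs hn h ↦ glued_sum_properties ha hodd hp hs hn h⟩
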